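/- Let $\mathbb F$ be an algebraically closed field of characteristic $0$. Let $P(z)\in\mathbb F[z]^{m\times n}$ be a matrix polynomial of grade $k\ge 2$ (all entries have degree at most $k$) and let $v(z)\in\mathbb F[z]$ be a scalar polynomial of degree exactly $k-1$ (that is, of grade $k-1$ and without infinite roots). An element $\lambda\in\mathbb F$ is an eigenvalue of $P(z)$ if $\operatorname{rank}P(\lambda)<\operatorname{rank}_{\mathbb F(z)}P(z)$. Assume that no root of $v(z)$ is an eigenvalue of $P(z)$. Let $L(z)=\mathbb{DL}(P,v)\in\mathbb F[z]^{km\times kn}$ be the $k\times k$ block matrix with blocks $L_{ab}(z)\in\mathbb F[z]^{m\times n}$ ($1\le a,b\le k$) determined by $$\sum_{a,b=1}^{k} y^{k-a}x^{k-b}L_{ab}(z)=\frac{P(y)(x-z)v(x)-P(x)(y-z)v(y)}{x-y}.$$ For a matrix polynomial $A(z)$ with $N$ columns put $\ker A(z)=\{x(z)\in\mathbb F(z)^{N}: A(z)x(z)=0\}$. A right minimal basis of $A(z)$ is a polynomial matrix whose columns form a basis of $\ker A(z)$ over $\mathbb F(z)$ with the least possible sum of column degrees among all polynomial bases of $\ker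 A(z)$, where the degree of a column is the largest degree of its entries; the degrees of its columns are called the right minimal indices of $A(z)$. Let $p=\dim_{\mathbb F(z)}\ker P(z)$ and let $M(z)\in\mathbb F[z]^{n\times p}$ be any right minimal basis of $P(z)$, with column degrees $\gamma_1,\dots,\gamma_p$ (the right minimal indices of $P(z)$). Let $\mu_1,\dots,\mu_s$ be the distinct roots of $v(z)$, with multiplicities $\ell_1,\dots,\ell_s$, let $V(z)=[z^{k-1},\dots,z,1]^T$ and $D(z)=V(z)\otimes M(z)$. For $1\le t\le s$ and $0\le a\le \ell_t-1$ let $$C_{t,a}=D^{(a)}(\mu_t)\in\mathbb F^{kn\times p},$$ where $D^{(a)}$ is the $a$-th derivative, and let $C$ be the constant matrix with block columns $C_{t,a}$. Let $H_{t,a}(z)$ be the Hermite interpolating polynomial, i.e. the unique polynomial of degree at most $k-2$ such that, for all $1\le r\le s$ and $0\le b\le \ell_r-1$, $H_{t,a}^{(b)}(\mu_r)=1$ if $(r,b)=(t,a)$ and $H_{t,a}^{(b)}(\mu_r)=0$ otherwise. Define $$E(z)=D(z)-\sum_{t=1}^{s}\sum_{a=0}^{\ell_t-1}H_{t,a}(z)\,C_{t,a},\qquad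 F(z)=\begin{bmatrix} C & \tfrac{1}{v(z)}E(z)\end{bmatrix}.$$ Then $C$ has $(k-1)p$ columns, $F(z)$ is a matrix polynomial (so $F(z)\in\mathbb F[z]^{kn\times kp}$), $F(z)$ is a right minimal basis of $L(z)$, and the degrees of its columns are $\underbrace{0,\dots,0}_{(k-1)p},\gamma_1,\dots,\gamma_p$, in this order. -/

import Mathlib

open Polynomial

namespace DLPencil

noncomputable section

/-! ### Matrix polynomials: kernels, eigenvalues, minimal bases -/

/-- A matrix polynomial regarded as a matrix over the field of rational functions `F(z)`. -/
def toRat {F : Type*} [Field F] {ι κ : Type*} (A : Matrix ι κ F[X]) : Matrix ι κ (RatFunc F) :=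
  A.map (algebraMap F[X] (RatFunc F))

/-- The right kernel `ker P(z) = {x(z) ∈ F(z)ⁿ : P(z) x(z) = 0}`, a subspace over `F(z)`. -/
def ratKer {F : Type*} [Field F] {ι κ : Type*} [Fintype κ] (P : Matrix ι κ F[X]) :
    Submodule (RatFunc F) (κ → RatFunc F) :=
  LinearMap.ker (toRat P).mulVecLin

/-- `a ∈ F` is a (finite) eigenvalue of `P(z)`: the rank of the constant matrix `P(a)` is less
than the normal rank of `P(z)`, i.e. its rank over `F(z)`. -/
def IsEigenvalue {F : Type*} [Field F] {ι κ : Type*} [Fintype κ]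
    (P : Matrix ι κ F[X]) (a : F) : Prop :=
  (P.map (Polynomial.eval a)).rank < (toRat P).rank

/-- The degree of the `j`-th column of a matrix polynomial: the largest degree of its entries. -/
def colDegree {F : Type*} [Field F] {ι κ : Type*} [Fintype ι]
    (A : Matrix ι κ F[X]) (j : κ) : ℕ :=
  Finset.univ.sup fun i => (A i j).natDegree

/-- The columns of the polynomial matrix `A(z)` form a basis over `F(z)` of the subspace `S`. -/
def IsPolynomialBasis {F : Type*} [Field F] {ι κ : Type*}
    (S : Submodule (RatFunc F) (ι → RatFunc F)) (A : Matrix ι κ F[X]) : Prop :=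
  LinearIndependent (RatFunc F) (toRat A).col ∧
    Submodule.span (RatFunc F) (Set.range (toRat A).col) = S

/-- The columns of `A(z)` form a minimal basis of `S`: a polynomial basis whose sum of column
degrees is minimal among all polynomial bases of `S`. -/
def IsMinimalBasis {F : Type*} [Field F] {ι κ : Type*} [Fintype ι] [Fintype κ]
    (S : Submodule (RatFunc F) (ι → RatFunc F)) (A : Matrix ι κ F[X]) : Prop :=
  IsPolynomialBasis S A ∧
    ∀ B : Matrix ι κ F[X], IsPolynomialBasis S B → ∑ j, colDegree A j ≤ ∑ j, colDegree B j

/-- `A(z)` is a right minimal basis of `P(z)`. The degrees of its columns are then the right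
minimal indices of `P(z)`. -/
def IsRightMinimalBasis {F : Type*} [Field F] {ι κ τ : Type*} [Fintype κ] [Fintype τ]
    (P : Matrix ι κ F[X]) (A : Matrix κ τ F[X]) : Prop :=
  IsMinimalBasis (ratKer P) A

/-! ### The pencil `DL(P, v)`

Trivariate polynomials are elements of `F[X][X][X]`: the outermost variable `X` is `x`, the middle
one `C X` is `y`, and the innermost one `C (C X)` is `z`. -/

/-- `p(x)`. -/
def inX {F : Type*} [Field F] (p : F[X]) : F[X][X][X] := p.map (C.comp C)

/-- `p(y)`. -/
def inY {F : Type*} [Field F] (p : F[X]) : F[X][X][X] := C (p.map C)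

/-- `p(y) (x - z) v(x) - p(x) (y - z) v(y)`. -/
def bezoutNum {F : Type*} [Field F] (p v : F[X]) : F[X][X][X] :=
  inY p * (X - C (C X)) * inX v - inX p * (C X - C (C X)) * inY v

/-- `(p(y) (x - z) v(x) - p(x) (y - z) v(y)) / (x - y)`; the division is exact. -/
def bezoutian {F : Type*} [Field F] (p v : F[X]) : F[X][X][X] :=
  bezoutNum p v /ₘ (X - C X)

/-- The pencil `DL(P, v)` for the grade `k`, a `k × k` block matrix with `m × n` blocks. Its block
in (zero-based) block row `a` and block column `b` is the coefficient of `y^(k-1-a) x^(k-1-b)` in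
`(P(y) (x - z) v(x) - P(x) (y - z) v(y)) / (x - y)`. -/
def DL {F : Type*} [Field F] {m n : ℕ} (k : ℕ) (P : Matrix (Fin m) (Fin n) F[X]) (v : F[X]) :
    Matrix (Fin k × Fin m) (Fin k × Fin n) F[X] :=
  fun r c => ((bezoutian (P r.2 c.2) v).coeff (k - 1 - c.1)).coeff (k - 1 - r.1)

theorem coeff_X_sub_C_mul' {R : Type*} [CommRing R] (a : R) (q : R[X]) (j : ℕ) :
    ((X - C a) * q).coeff (j + 1) = q.coeff j - a * q.coeff (j + 1) := by
  rw [sub_mul, coeff_sub, coeff_C_mul, coeff_X_mul]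

theorem coeff_X_sub_C_mul_zero' {R : Type*} [CommRing R] (a : R) (q : R[X]) :
    ((X - C a) * q).coeff 0 = -(a * q.coeff 0) := by
  simp [sub_mul]

theorem bezoutian_mul {F : Type*} [Field F] (p v : F[X]) :
    (X - C X) * bezoutian p v = bezoutNum p v := by
  unfold bezoutian
  rw [mul_divByMonic_eq_iff_isRoot]
  have h : ∀ q : F[X], (inX q).eval (X : F[X][X]) = q.map C := by
    intro q
    rw [inX, ← Polynomial.map_map, eval_map, eval₂_C_X]
  simp only [IsRoot, bezoutNum, inY, eval_sub, eval_mul, eval_C, eval_X, h]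
  ring

theorem natDegree_inX_le {F : Type*} [Field F] (p : F[X]) : (inX p).natDegree ≤ p.natDegree :=
  natDegree_map_le

theorem natDegree_bezoutNum_le {F : Type*} [Field F] {k : ℕ} (hk : 1 ≤ k) {p v : F[X]}
    (hp : p.natDegree ≤ k) (hv : v.natDegree ≤ k - 1) : (bezoutNum p v).natDegree ≤ k := by
  have h1 := (natDegree_inX_le p).trans hp
  have h2 := (natDegree_inX_le v).trans hv
  have h3 : (inY p * (X - C (C X)) * inX v).natDegree ≤ 0 + 1 + (k - 1) := by
    refine natDegree_mul_le_of_le (natDegree_mul_le_of_le ?_ ?_) h2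
    · simp [inY]
    · simp
  have h4 : (inX p * (C X - C (C X)) * inY v).natDegree ≤ k + 0 + 0 := by
    refine natDegree_mul_le_of_le (natDegree_mul_le_of_le h1 ?_) ?_
    · rw [← C_sub, natDegree_C]
    · simp [inY]
  refine (natDegree_sub_le _ _).trans ?_
  omega

theorem natDegree_coeff_bezoutNum_le {F : Type*} [Field F] {k : ℕ} (hk : 1 ≤ k) {p v : F[X]}
    (hp : p.natDegree ≤ k) (hv : v.natDegree ≤ k - 1) (j : ℕ) :
    ((bezoutNum p v).coeff j).natDegree ≤ k := by
  have hX : ∀ (q : F[X]) (i : ℕ), ((inX q).coeff i).natDegree ≤ 0 := by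
    intro q i
    simp [inX, coeff_map]
  have hp' : (p.map (C : F →+* F[X])).natDegree ≤ k := natDegree_map_le.trans hp
  have hv' : (v.map (C : F →+* F[X])).natDegree ≤ k - 1 := natDegree_map_le.trans hv
  have e : bezoutNum p v = C (p.map C) * ((X - C (C X)) * inX v)
      - inX p * C ((X - C X) * v.map C) := by
    simp only [bezoutNum, inY, C_mul, C_sub]
    ring
  rw [e, coeff_sub, coeff_C_mul, coeff_mul_C]
  have h1 : (((X - C (C X)) * inX v).coeff j).natDegree ≤ 0 := by
    cases j with
    | zero =>
      rw [coeff_X_sub_C_mul_zero', natDegree_neg]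
      exact (natDegree_C_mul_le _ _).trans (hX v 0)
    | succ j =>
      rw [coeff_X_sub_C_mul']
      refine (natDegree_sub_le _ _).trans (max_le (hX v j) ?_)
      exact (natDegree_C_mul_le _ _).trans (hX v (j + 1))
  have h2 : ((X - C X : F[X][X]) * v.map C).natDegree ≤ 1 + (k - 1) :=
    natDegree_mul_le_of_le (by simp) hv'
  have h3 := natDegree_mul_le_of_le hp' h1
  have h4 := natDegree_mul_le_of_le (hX p j) h2
  refine (natDegree_sub_le _ _).trans ?_
  omega

theorem natDegree_bezoutian_lt {F : Type*} [Field F] {k : ℕ} (hk : 1 ≤ k) {p v : F[X]}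
    (hp : p.natDegree ≤ k) (hv : v.natDegree ≤ k - 1) : (bezoutian p v).natDegree < k := by
  have h := natDegree_bezoutNum_le hk hp hv
  rw [bezoutian, natDegree_divByMonic _ (monic_X_sub_C _), natDegree_X_sub_C]
  omega

theorem natDegree_coeff_bezoutian_lt {F : Type*} [Field F] {k : ℕ} (hk : 1 ≤ k) {p v : F[X]}
    (hp : p.natDegree ≤ k) (hv : v.natDegree ≤ k - 1) (j : ℕ) :
    ((bezoutian p v).coeff j).natDegree < k := by
  have key : ∀ q : F[X][X], (X * q).natDegree ≤ k → q.natDegree < k := by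
    intro q hq
    by_cases h0 : q = 0
    · subst h0; simp; omega
    · rw [natDegree_X_mul h0] at hq; omega
  have hN := natDegree_coeff_bezoutNum_le hk hp hv
  have hmul := bezoutian_mul p v
  induction j with
  | zero =>
    apply key
    have := hN 0
    rwa [← hmul, coeff_X_sub_C_mul_zero', natDegree_neg] at this
  | succ j ih =>
    apply key
    have h1 := hN (j + 1)
    have e : X * (bezoutian p v).coeff (j + 1)
        = (bezoutian p v).coeff j - (bezoutNum p v).coeff (j + 1) := by
      rw [← hmul, coeff_X_sub_C_mul']
      ring
    rw [e]
    refine (natDegree_sub_le _ _).trans ?_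
    omega

/-- The block matrix `DL(P, v)` corresponds, under the bijection between block matrices and
bivariate matrix polynomials, to the Bézoutian:
`∑ₐ ∑_b y^(k-1-a) x^(k-1-b) DL(P, v)_{ab}(z) = (P(y)(x-z)v(x) - P(x)(y-z)v(y)) / (x - y)`. -/
theorem DL_spec {F : Type*} [Field F] {m n k : ℕ} (hk : 1 ≤ k)
    (P : Matrix (Fin m) (Fin n) F[X]) (v : F[X]) (hP : ∀ i j, (P i j).natDegree ≤ k)
    (hv : v.natDegree ≤ k - 1) (i : Fin m) (j : Fin n) :
    (X - C X) * (∑ a : Fin k, ∑ b : Fin k,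
      (C X) ^ (k - 1 - (a : ℕ)) * X ^ (k - 1 - (b : ℕ)) * C (C (DL k P v (a, i) (b, j))))
      = bezoutNum (P i j) v := by
  rw [← bezoutian_mul]
  congr 1
  set q := bezoutian (P i j) v with hq
  have hx : q.natDegree < k := natDegree_bezoutian_lt hk (hP i j) hv
  have hy : ∀ t, (q.coeff t).natDegree < k := natDegree_coeff_bezoutian_lt hk (hP i j) hv
  have e1 : q = ∑ b : Fin k, C (∑ a : Fin k, C ((q.coeff (k - 1 - (b : ℕ))).coeff (k - 1 - (a : ℕ)))
      * X ^ (k - 1 - (a : ℕ))) * X ^ (k - 1 - (b : ℕ)) := by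
    conv_lhs => rw [q.as_sum_range_C_mul_X_pow' hx]
    rw [← Finset.sum_range_reflect, Finset.sum_range]
    refine Finset.sum_congr rfl fun b _ => ?_
    congr 2
    conv_lhs => rw [(q.coeff (k - 1 - (b : ℕ))).as_sum_range_C_mul_X_pow' (hy _)]
    rw [← Finset.sum_range_reflect, Finset.sum_range]
  conv_rhs => rw [e1]
  rw [Finset.sum_comm]
  refine Finset.sum_congr rfl fun b _ => ?_
  rw [map_sum, Finset.sum_mul]
  refine Finset.sum_congr rfl fun a _ => ?_
  simp only [DL, C_mul, C_pow, ← hq]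
  ring

/-! ### Hermite interpolation -/

/-- `H` is the Hermite interpolating polynomial for the nodes `μ₁, …, μₛ` with multiplicities
`ℓ₁, …, ℓₛ` that belongs to the index `i = (j, a)`, `0 ≤ a ≤ ℓⱼ - 1`: its degree is less than the
number `ℓ₁ + ⋯ + ℓₛ` of interpolation conditions, `H^(a)(μⱼ) = 1`, and `H^(b)(μₜ) = 0` for all
other pairs `(t, b)` with `0 ≤ b ≤ ℓₜ - 1`. -/
def IsHermitePoly {F : Type*} [Field F] {s : ℕ} (μ : Fin s → F) (l : Fin s → ℕ)
    (i : Σ t : Fin s, Fin (l t)) (H : F[X]) : Prop :=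
  H.degree < ((∑ t, l t : ℕ) : WithBot ℕ) ∧
    ∀ j : Σ t : Fin s, Fin (l t),
      (derivative^[(j.2 : ℕ)] H).eval (μ j.1) = if j = i then 1 else 0

theorem hermite_injective {F : Type*} [Field F] [CharZero F] {s : ℕ} {μ : Fin s → F}
    (hμ : Function.Injective μ) (l : Fin s → ℕ) {H : F[X]}
    (hd : H.degree < ((∑ t, l t : ℕ) : WithBot ℕ))
    (h0 : ∀ j : Σ t : Fin s, Fin (l t), (derivative^[(j.2 : ℕ)] H).eval (μ j.1) = 0) : H = 0 := by
  by_contra hne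
  have hdvd : (∏ t, (X - C (μ t)) ^ l t) ∣ H := by
    refine Finset.prod_dvd_of_coprime ?_ ?_
    · intro a _ b _ hab
      exact (isCoprime_X_sub_C_of_isUnit_sub
        (sub_ne_zero.mpr (hμ.ne hab)).isUnit).pow
    · intro t _
      rw [← le_rootMultiplicity_iff hne]
      by_contra hlt
      push Not at hlt
      have := (lt_rootMultiplicity_iff_isRoot_iterate_derivative (p := H) (t := μ t)
        (n := H.rootMultiplicity (μ t)) hne).mpr
        (fun b hb => h0 ⟨t, ⟨b, lt_of_le_of_lt hb hlt⟩⟩)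
      exact lt_irrefl _ this
  have h1 := degree_le_of_dvd hdvd hne
  rw [degree_prod] at h1
  simp only [degree_pow, degree_X_sub_C, nsmul_eq_mul, mul_one] at h1
  push_cast at hd
  exact absurd (lt_of_le_of_lt h1 hd) (lt_irrefl _)

theorem existsUnique_isHermitePoly {F : Type*} [Field F] [CharZero F] {s : ℕ} {μ : Fin s → F}
    (hμ : Function.Injective μ) (l : Fin s → ℕ) (i : Σ t : Fin s, Fin (l t)) :
    ∃! H : F[X], IsHermitePoly μ l i H := by
  let T : degreeLT F (∑ t, l t) →ₗ[F] ((Σ t : Fin s, Fin (l t)) → F) :=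
    LinearMap.pi fun j => (leval (μ j.1)).comp
      (((derivative : F[X] →ₗ[F] F[X]) ^ (j.2 : ℕ)).comp (degreeLT F (∑ t, l t)).subtype)
  have hT : ∀ H j, T H j = (derivative^[(j.2 : ℕ)] (H : F[X])).eval (μ j.1) := by
    intro H j
    simp [T, leval, Module.End.pow_apply]
  have hinj : Function.Injective T := by
    rw [injective_iff_map_eq_zero]
    intro H hH
    apply Subtype.ext
    refine hermite_injective hμ l (mem_degreeLT.mp H.2) fun j => ?_
    rw [← hT, hH]
    rfl
  have hfin : Module.finrank F (degreeLT F (∑ t, l t))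
      = Module.finrank F ((Σ t : Fin s, Fin (l t)) → F) := by
    rw [(degreeLTEquiv F (∑ t, l t)).finrank_eq]
    simp
  have : FiniteDimensional F (degreeLT F (∑ t, l t)) :=
    (degreeLTEquiv F (∑ t, l t)).symm.finiteDimensional
  have hsurj := (LinearMap.injective_iff_surjective_of_finrank_eq_finrank hfin).mp hinj
  obtain ⟨H, hH⟩ := hsurj fun j => if j = i then 1 else 0
  refine ⟨H, ⟨mem_degreeLT.mp H.2, fun j => by rw [← hT, hH]⟩, ?_⟩
  rintro G ⟨hG1, hG2⟩
  have : (⟨G, mem_degreeLT.mpr hG1⟩ : degreeLT F (∑ t, l t)) = H := by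
    apply hinj
    rw [hH]
    funext j
    rw [hT]
    exact hG2 j
  exact congrArg Subtype.val this

/-- The Hermite interpolating polynomials; they exist and are unique for distinct nodes by
`existsUnique_isHermitePoly`. -/
def hermitePoly {F : Type*} [Field F] {s : ℕ} (μ : Fin s → F) (l : Fin s → ℕ)
    (i : Σ t : Fin s, Fin (l t)) : F[X] :=
  Classical.epsilon (IsHermitePoly μ l i)

theorem hermitePoly_spec {F : Type*} [Field F] [CharZero F] {s : ℕ} {μ : Fin s → F}
    (hμ : Function.Injective μ) (l : Fin s → ℕ) (i : Σ t : Fin s, Fin (l t)) :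
    IsHermitePoly μ l i (hermitePoly μ l i) :=
  Classical.epsilon_spec (existsUnique_isHermitePoly hμ l i).exists

/-! ### The matrices `D(z)`, `C`, `E(z)` and `F(z)` -/

/-- `D(z) = V(z) ⊗ M(z)`, where `V(z) = (z^(k-1), …, z, 1)ᵀ`. -/
def matD {F : Type*} [Field F] {n p : ℕ} (k : ℕ) (M : Matrix (Fin n) (Fin p) F[X]) :
    Matrix (Fin k × Fin n) (Fin p) F[X] :=
  fun r j => X ^ (k - 1 - (r.1 : ℕ)) * M r.2 j

/-- The constant matrix `C`, with one block column `[V(z) ⊗ M(z)]^(a)` evaluated at `z = μₜ`, with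
`p` columns, for each pair `(t, a)` with `0 ≤ a ≤ ℓₜ - 1`. -/
def matC {F : Type*} [Field F] {n p s : ℕ} (k : ℕ) (M : Matrix (Fin n) (Fin p) F[X])
    (μ : Fin s → F) (l : Fin s → ℕ) :
    Matrix (Fin k × Fin n) ((Σ t : Fin s, Fin (l t)) × Fin p) F :=
  fun r c => (derivative^[(c.1.2 : ℕ)] (matD k M r c.2)).eval (μ c.1.1)

/-- `E(z) = D(z) - ∑ᵢ Hᵢ(z) Cᵢ`, where `Cᵢ` are the block columns of `C` and `Hᵢ(z)` the
Hermite interpolating polynomials. -/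
def matE {F : Type*} [Field F] {n p s : ℕ} (k : ℕ) (M : Matrix (Fin n) (Fin p) F[X])
    (μ : Fin s → F) (l : Fin s → ℕ) : Matrix (Fin k × Fin n) (Fin p) F[X] :=
  fun r j => matD k M r j -
    ∑ i : Σ t : Fin s, Fin (l t), hermitePoly μ l i * C (matC k M μ l r (i, j))

/-- `F(z) = [C, E(z) / v(z)]`, as a matrix over `F(z)`. -/
def matF {F : Type*} [Field F] {n p s : ℕ} (k : ℕ) (M : Matrix (Fin n) (Fin p) F[X])
    (v : F[X]) (μ : Fin s → F) (l : Fin s → ℕ) :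
    Matrix (Fin k × Fin n) (((Σ t : Fin s, Fin (l t)) × Fin p) ⊕ Fin p) (RatFunc F) :=
  Matrix.fromCols (toRat ((matC k M μ l).map C))
    ((algebraMap F[X] (RatFunc F) v)⁻¹ • toRat (matE k M μ l))

end

end DLPencil

/-! # Minimal bases of pencils in `DL(P)`: singular matrix polynomials

Write `K = F(z)`. Two criteria on polynomial bases carry the proof. If the columns of `A(z)` form a
basis of `S`, if `A(a)` has full column rank for every `a ∈ F` (`HasFullColRank`), and if the
highest column degree coefficient matrix of `A(z)` has full column rank (`IsColumnReduced`), then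
`A(z)` is minimal: any other polynomial basis is `A U` with `U` polynomial and nonsingular, `U` has
nonzero entries along some permutation, and the leading terms in `A U` cannot cancel. Conversely, a
minimal basis has both properties, since otherwise one of its columns could be exchanged for a
polynomial vector of smaller degree.

*The columns of `F(z)` lie in the kernel.* If `P g = 0`, the Bézoutian that defines `DL(P, v)`,
applied to `g(x)`, is divisible by `(x - z) v(x)` (`dvd_sum_inX_mul_bezoutian`). Evaluation at
`x = z` gives `DL(P, v) D = 0`, and the derivatives at the roots of `v` give `DL(P, v) C = 0`.

*The kernel has dimension at most `k p`.* The numerator of the Bézoutian is `P(y) f(x) - P(x) f(y)`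
with `f(y) = (y - z) v(y)` of degree `k`. Therefore the kernel embeds into the space of vectors
`w ∈ K[y]ⁿ` of degree less than `k` with `P w ≡ 0` modulo `f` (`bezoutMap`,
`modulus_dvd_of_mem_ratKer`). No root of `f` is an eigenvalue of `P`: the root `z` is
transcendental, and the other roots are those of `v`. So the kernel of `P` at such a root is spanned
by the columns of `M`, and splitting off one linear factor of `f` after the other shows that `w` is
congruent to a combination of the columns of `M` (`exists_eq_mulVec_add_smul`), whose coefficients
may be reduced modulo `f`.

*Ranks and degrees of `F(z)`.* For a polynomial `q(z)` of degree less than `k`, the coefficient row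
of `q` applied to the block rows of `D` gives `q M`. Testing with suitable `q` of degree at most
`k - 2` shows that `C` has full column rank even without its first block row
(`eq_zero_of_matC_mulVec_eq_zero`). Testing with `q = v` annihilates `C` and maps `E / v` to `M`, so
`F(a)` has full column rank for every `a`. Since the interpolation polynomials have degree at most
`k - 2`, the terms of highest degree in `E / v` are those of `M`, up to a constant, in the first
block row, and they vanish in the other block rows; this gives the column degrees, and that `F(z)`
is column reduced. Hence its columns are `k p` independent vectors of the kernel, and the first
criterion applies.
-/

namespace DLPencil

/-! ### Minimal bases: full column rank and column reducedness -/

section MinimalBasis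

variable {F : Type*} [Field F] {ι κ : Type*}

/-- The highest column degree coefficient matrix of `A(z)`: its `j`-th column consists of the
coefficients of `z^d` in the `j`-th column of `A(z)`, where `d` is the degree of that column. -/
def leadingColMatrix [Fintype ι] (A : Matrix ι κ F[X]) : Matrix ι κ F :=
  fun i j => (A i j).coeff (colDegree A j)

/-- `A(a)` has full column rank for every `a ∈ F`. -/
def HasFullColRank [Fintype κ] (A : Matrix ι κ F[X]) : Prop :=
  ∀ (a : F) (c : κ → F), (A.map (Polynomial.eval a)).mulVec c = 0 → c = 0

/-- `A(z)` is column reduced: its highest column degree coefficient matrix has full column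
rank. -/
def IsColumnReduced [Fintype ι] [Fintype κ] (A : Matrix ι κ F[X]) : Prop :=
  ∀ c : κ → F, (leadingColMatrix A).mulVec c = 0 → c = 0

theorem natDegree_le_colDegree [Fintype ι] (A : Matrix ι κ F[X]) (i : ι) (j : κ) :
    (A i j).natDegree ≤ colDegree A j :=
  Finset.le_sup (f := fun i => (A i j).natDegree) (Finset.mem_univ i)

theorem eval_mulVec {R : Type*} [CommSemiring R] [Fintype κ] (A : Matrix ι κ R[X])
    (u : κ → R[X]) (a : R) :
    (fun i => (A.mulVec u i).eval a) = (A.map (Polynomial.eval a)).mulVec fun j => (u j).eval a := by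
  funext i
  simp [Matrix.mulVec, dotProduct, eval_finsetSum]

theorem toRat_mulVec [Fintype κ] (A : Matrix ι κ F[X]) (u : κ → F[X]) :
    (toRat A).mulVec (fun j => algebraMap F[X] (RatFunc F) (u j)) =
      fun i => algebraMap F[X] (RatFunc F) (A.mulVec u i) := by
  funext i
  simp [Matrix.mulVec, dotProduct, toRat]

theorem toRat_mul [Fintype κ] {τ : Type*} (A : Matrix ι κ F[X]) (B : Matrix κ τ F[X]) :
    toRat (A * B) = toRat A * toRat B := by
  unfold toRat
  exact Matrix.map_mul

theorem toRat_injective : Function.Injective (toRat : Matrix ι κ F[X] → Matrix ι κ (RatFunc F)) :=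
  Matrix.map_injective (IsFractionRing.injective F[X] (RatFunc F))

theorem algebraMap_ratFunc_injective : Function.Injective (algebraMap F[X] (RatFunc F)) :=
  IsFractionRing.injective F[X] (RatFunc F)

theorem exists_common_denominator [Finite κ] (x : κ → RatFunc F) :
    ∃ (d : F[X]) (u : κ → F[X]), d ≠ 0 ∧
      ∀ j, algebraMap F[X] (RatFunc F) d * x j = algebraMap F[X] (RatFunc F) (u j) := by
  obtain ⟨b, hb⟩ := IsLocalization.exist_integer_multiples_of_finite (nonZeroDivisors F[X]) x
  choose u hu using hb
  refine ⟨b, u, nonZeroDivisors.ne_zero b.2, fun j => ?_⟩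
  rw [hu j, Algebra.smul_def]

/-- If `A(z)` has full column rank at every point, then a common factor of `A(z) u(z)` is a common
factor of `u(z)`. -/
theorem HasFullColRank.exists_eq_smul [IsAlgClosed F] [Fintype κ] {A : Matrix ι κ F[X]}
    (hA : HasFullColRank A) {w : ι → F[X]} {d : F[X]} (hd : d ≠ 0) {u : κ → F[X]}
    (h : A.mulVec u = d • w) : ∃ u' : κ → F[X], u = d • u' := by
  induction hn : d.natDegree generalizing d u with
  | zero =>
    rw [natDegree_eq_zero] at hn
    obtain ⟨c, rfl⟩ := hn
    have hc : c ≠ 0 := by rintro rfl; simp at hd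
    refine ⟨C c⁻¹ • u, ?_⟩
    rw [smul_smul, ← C_mul, mul_inv_cancel₀ hc, C_1, one_smul]
  | succ n ih =>
    have hdeg : d.degree ≠ 0 := by
      rw [degree_eq_natDegree hd, hn]
      exact_mod_cast Nat.succ_ne_zero n
    obtain ⟨a, ha⟩ := IsAlgClosed.exists_root d hdeg
    obtain ⟨d', rfl⟩ := dvd_iff_isRoot.mpr ha
    have hd' : d' ≠ 0 := right_ne_zero_of_mul hd
    have h0 : (fun j => (u j).eval a) = 0 := by
      apply hA a
      rw [← eval_mulVec, h]
      funext i
      simp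
    have hdvd : ∀ j, ∃ q, u j = (X - C a) * q := fun j =>
      dvd_iff_isRoot.mpr (congrFun h0 j)
    choose u₁ hu₁ using hdvd
    have hu : u = (X - C a) • u₁ := funext hu₁
    have h1 : A.mulVec u₁ = d' • w := by
      rw [hu, Matrix.mulVec_smul, mul_smul] at h
      funext i
      have := congrFun h i
      simp only [Pi.smul_apply, smul_eq_mul] at this ⊢
      exact mul_left_cancel₀ (X_sub_C_ne_zero a) this
    rw [natDegree_mul (X_sub_C_ne_zero a) hd', natDegree_X_sub_C] at hn
    obtain ⟨u', hu'⟩ := ih hd' h1 (by omega)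
    exact ⟨u', by rw [hu, hu', smul_smul]⟩

/-- If `A(z)` has full column rank at every point, then a rational combination of its columns that
is polynomial has polynomial coefficients. -/
theorem HasFullColRank.exists_polynomial [IsAlgClosed F] [Fintype κ] {A : Matrix ι κ F[X]}
    (hA : HasFullColRank A) {w : ι → F[X]} {x : κ → RatFunc F}
    (h : (toRat A).mulVec x = fun i => algebraMap F[X] (RatFunc F) (w i)) :
    ∃ u : κ → F[X], x = fun j => algebraMap F[X] (RatFunc F) (u j) := by
  obtain ⟨d, u, hd, hu⟩ := exists_common_denominator x
  have hd' : algebraMap F[X] (RatFunc F) d ≠ 0 := by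
    rwa [Ne, map_eq_zero_iff _ algebraMap_ratFunc_injective]
  have h1 : A.mulVec u = d • w := by
    have h2 := toRat_mulVec A u
    have h3 : (fun j => algebraMap F[X] (RatFunc F) (u j)) =
        algebraMap F[X] (RatFunc F) d • x := funext fun j => (hu j).symm
    rw [h3, Matrix.mulVec_smul, h] at h2
    funext i
    apply algebraMap_ratFunc_injective
    rw [← congrFun h2 i]
    simp
  obtain ⟨u', rfl⟩ := hA.exists_eq_smul hd h1
  refine ⟨u', funext fun j => mul_left_cancel₀ hd' ?_⟩
  rw [hu j]
  simp

/-- The predictable degree property: cancellation of the leading terms in a polynomial combination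
of the columns of a column reduced matrix is impossible. -/
theorem IsColumnReduced.exists_colDegree_le [Fintype ι] [Fintype κ] {A : Matrix ι κ F[X]}
    (hA : IsColumnReduced A) {u : κ → F[X]} (hu : u ≠ 0) :
    ∃ i, A.mulVec u i ≠ 0 ∧ ∀ j, u j ≠ 0 → colDegree A j ≤ (A.mulVec u i).natDegree := by
  classical
  obtain ⟨j₀, hj₀⟩ := Function.ne_iff.mp hu
  obtain ⟨j₁, hj₁, hmax⟩ := Finset.exists_max_image (Finset.univ.filter fun j => u j ≠ 0)
    (fun j => colDegree A j + (u j).natDegree) ⟨j₀, by simpa using hj₀⟩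
  simp only [Finset.mem_filter, Finset.mem_univ, true_and] at hj₁ hmax
  set d := colDegree A j₁ + (u j₁).natDegree with hd
  let c : κ → F := fun j => if u j = 0 then 0 else (u j).coeff (d - colDegree A j)
  have hcoeff : ∀ i, (A.mulVec u i).coeff d = (leadingColMatrix A).mulVec c i := by
    intro i
    simp only [Matrix.mulVec, dotProduct, finsetSum_coeff]
    refine Finset.sum_congr rfl fun j _ => ?_
    by_cases h : u j = 0
    · simp [h, c]
    · have h1 := hmax j h
      have h2 : d = colDegree A j + (d - colDegree A j) := by omega
      conv_lhs => rw [h2]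
      rw [coeff_mul_add_eq_of_natDegree_le (natDegree_le_colDegree A i j) (by omega)]
      simp [c, h, leadingColMatrix]
  have hc : c ≠ 0 := by
    intro h0
    have := congrFun h0 j₁
    simp only [c, hj₁, if_false, hd, Nat.add_sub_cancel_left, Pi.zero_apply] at this
    exact hj₁ (leadingCoeff_eq_zero.mp this)
  obtain ⟨i, hi⟩ := Function.ne_iff.mp (fun h => hc (hA c h))
  rw [← hcoeff i] at hi
  refine ⟨i, fun h => hi (by rw [h]; simp), fun j hj => ?_⟩
  have h1 := hmax j hj
  have h2 := le_natDegree_of_ne_zero hi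
  omega

theorem IsColumnReduced.linearIndependent [Fintype ι] [Fintype κ] {A : Matrix ι κ F[X]}
    (hA : IsColumnReduced A) : LinearIndependent (RatFunc F) (toRat A).col := by
  rw [← Matrix.mulVec_injective_iff, ← Matrix.coe_mulVecLin, injective_iff_map_eq_zero]
  intro x hx
  rw [Matrix.mulVecLin_apply] at hx
  obtain ⟨d, u, hd, hu⟩ := exists_common_denominator x
  have hd' : algebraMap F[X] (RatFunc F) d ≠ 0 := by
    rwa [Ne, map_eq_zero_iff _ algebraMap_ratFunc_injective]
  have h3 : (fun j => algebraMap F[X] (RatFunc F) (u j)) =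
      algebraMap F[X] (RatFunc F) d • x := funext fun j => (hu j).symm
  have h2 := toRat_mulVec A u
  rw [h3, Matrix.mulVec_smul, hx, smul_zero] at h2
  have hu0 : u = 0 := by
    by_contra hne
    obtain ⟨i, hi, -⟩ := hA.exists_colDegree_le hne
    apply hi
    apply algebraMap_ratFunc_injective
    rw [← congrFun h2 i]
    simp
  funext j
  have := hu j
  rw [hu0] at this
  simpa [hd'] using this

theorem IsPolynomialBasis.mul [Fintype κ] [DecidableEq κ]
    {S : Submodule (RatFunc F) (ι → RatFunc F)} {A B : Matrix ι κ F[X]}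
    (hA : IsPolynomialBasis S A) {U : Matrix κ κ (RatFunc F)} (hU : U.det ≠ 0)
    (hB : toRat B = toRat A * U) : IsPolynomialBasis S B := by
  obtain ⟨h1, h2⟩ := hA
  have hU' : IsUnit U := (Matrix.isUnit_iff_isUnit_det U).mpr hU.isUnit
  constructor
  · rw [← Matrix.mulVec_injective_iff] at h1 ⊢
    have : (toRat B).mulVec = (toRat A).mulVec ∘ U.mulVec := by
      funext x
      simp [hB, Matrix.mulVec_mulVec]
    rw [this]
    exact h1.comp (Matrix.mulVec_injective_iff_isUnit.mpr hU')
  · rw [← h2, ← Matrix.range_mulVecLin, ← Matrix.range_mulVecLin, hB, Matrix.mulVecLin_mul,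
      LinearMap.range_comp_of_range_eq_top]
    exact LinearMap.range_eq_top.mpr (Matrix.mulVec_surjective_iff_isUnit.mpr hU')

/-- The sufficient condition for minimality: a polynomial basis of full column rank at every point
that is column reduced is minimal. Any other polynomial basis is `A U` with `U` polynomial and
nonsingular; a permutation along which `U` has nonzero entries matches the column degrees. -/
theorem isMinimalBasis_of_hasFullColRank_of_isColumnReduced [IsAlgClosed F] [Fintype ι] [Fintype κ]
    {S : Submodule (RatFunc F) (ι → RatFunc F)} {A : Matrix ι κ F[X]}
    (hA : IsPolynomialBasis S A) (h1 : HasFullColRank A) (h2 : IsColumnReduced A) :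
    IsMinimalBasis S A := by
  classical
  refine ⟨hA, fun B hB => ?_⟩
  have hU : ∀ j, ∃ u : κ → F[X], A.mulVec u = fun i => B i j := by
    intro j
    have hmem : (toRat B).col j ∈ Submodule.span (RatFunc F) (Set.range (toRat A).col) := by
      rw [hA.2, ← hB.2]
      exact Submodule.subset_span ⟨j, rfl⟩
    rw [← Matrix.range_mulVecLin] at hmem
    obtain ⟨x, hx⟩ := hmem
    have hx' : (toRat A).mulVec x = fun i => algebraMap F[X] (RatFunc F) (B i j) := hx
    obtain ⟨u, rfl⟩ := h1.exists_polynomial hx'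
    rw [toRat_mulVec] at hx'
    exact ⟨u, funext fun i => algebraMap_ratFunc_injective (congrFun hx' i)⟩
  choose u hu using hU
  let U : Matrix κ κ F[X] := fun i j => u j i
  have hAU : A * U = B := by
    ext1 i j
    exact congrFun (hu j) i
  have hdet : U.det ≠ 0 := by
    intro h0
    have hinj := Matrix.mulVec_injective_iff.mpr hB.1
    have hd : (toRat U).det = 0 := by
      have := (algebraMap F[X] (RatFunc F)).map_det U
      rw [h0, map_zero] at this
      exact this.symm
    obtain ⟨x, hx, hx0⟩ := Matrix.exists_mulVec_eq_zero_iff.mpr hd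
    apply hx
    apply hinj
    rw [← hAU, toRat_mul, ← Matrix.mulVec_mulVec, hx0, Matrix.mulVec_zero, Matrix.mulVec_zero]
  obtain ⟨σ, hσ⟩ : ∃ σ : Equiv.Perm κ, ∀ j, U (σ j) j ≠ 0 := by
    by_contra hno
    push Not at hno
    apply hdet
    rw [Matrix.det_apply]
    refine Finset.sum_eq_zero fun σ _ => ?_
    obtain ⟨j, hj⟩ := hno σ
    have h0 : ∏ i, U (σ i) i = 0 := Finset.prod_eq_zero (Finset.mem_univ j) hj
    exact (congrArg (Equiv.Perm.sign σ • ·) h0).trans (smul_zero _)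
  rw [← Equiv.sum_comp σ]
  refine Finset.sum_le_sum fun j _ => ?_
  have hne : u j ≠ 0 := fun h => hσ j (congrFun h (σ j))
  obtain ⟨i, -, hi⟩ := h2.exists_colDegree_le hne
  refine (hi (σ j) (hσ j)).trans ?_
  rw [hu j]
  exact natDegree_le_colDegree B i j

/-- The exchange property of a minimal basis: a polynomial vector that involves the `j`-th basis
vector has at least the degree of that vector. -/
theorem IsMinimalBasis.colDegree_le [Fintype ι] [Fintype κ]
    {S : Submodule (RatFunc F) (ι → RatFunc F)} {A : Matrix ι κ F[X]} (hA : IsMinimalBasis S A)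
    {x : κ → RatFunc F} {w : ι → F[X]}
    (h : (toRat A).mulVec x = fun i => algebraMap F[X] (RatFunc F) (w i)) {j : κ} (hj : x j ≠ 0) :
    colDegree A j ≤ Finset.univ.sup fun i => (w i).natDegree := by
  classical
  let B : Matrix ι κ F[X] := A.updateCol j w
  let U : Matrix κ κ (RatFunc F) := (1 : Matrix κ κ (RatFunc F)).updateCol j x
  have hU : U.det ≠ 0 := by
    rw [← Matrix.cramer_apply, Matrix.cramer_one]
    exact hj
  have hB : toRat B = toRat A * U := by
    ext i t
    by_cases ht : t = j
    · subst ht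
      have := congrFun h i
      simp only [toRat, Matrix.map_apply, B, Matrix.updateCol_self]
      rw [← this]
      simp [Matrix.mul_apply, U, Matrix.mulVec, dotProduct, toRat]
    · simp only [toRat, Matrix.map_apply, B, Matrix.updateCol_ne ht, Matrix.mul_apply, U]
      simp [Matrix.one_apply]
  have hle := hA.2 B (hA.1.mul hU hB)
  have hother : ∀ t ∈ Finset.univ.erase j, colDegree B t = colDegree A t := by
    intro t ht
    simp [colDegree, B, Matrix.updateCol_ne (Finset.ne_of_mem_erase ht)]
  have hsum : ∑ t ∈ Finset.univ.erase j, colDegree B t = ∑ t ∈ Finset.univ.erase j, colDegree A t :=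
    Finset.sum_congr rfl hother
  have hsumA := Finset.add_sum_erase _ (fun t => colDegree A t) (Finset.mem_univ j)
  have hsumB := Finset.add_sum_erase _ (fun t => colDegree B t) (Finset.mem_univ j)
  have hBj : colDegree B j = Finset.univ.sup fun i => (w i).natDegree := by
    simp [colDegree, B]
  omega

theorem IsPolynomialBasis.mulVec_eq_zero [Fintype κ]
    {S : Submodule (RatFunc F) (ι → RatFunc F)} {A : Matrix ι κ F[X]} (hA : IsPolynomialBasis S A)
    {u : κ → F[X]} (h : A.mulVec u = 0) : u = 0 := by
  have hinj := Matrix.mulVec_injective_iff.mpr hA.1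
  have h1 := toRat_mulVec A u
  rw [h] at h1
  have h2 : (toRat A).mulVec (fun j => algebraMap F[X] (RatFunc F) (u j)) =
      (toRat A).mulVec 0 := by
    rw [h1, Matrix.mulVec_zero]
    funext i
    simp
  have h3 := hinj h2
  funext j
  apply algebraMap_ratFunc_injective
  rw [congrFun h3 j]
  simp

/-- A minimal basis has full column rank at every point: otherwise some combination of its columns
is divisible by `z - a`, and the quotient can be exchanged for a column of larger degree. -/
theorem IsMinimalBasis.hasFullColRank [Fintype ι] [Fintype κ]
    {S : Submodule (RatFunc F) (ι → RatFunc F)} {A : Matrix ι κ F[X]} (hA : IsMinimalBasis S A) :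
    HasFullColRank A := by
  classical
  intro a c hc
  by_contra hne
  obtain ⟨j₀, hj₀⟩ := Function.ne_iff.mp hne
  obtain ⟨j, hj, hmax⟩ := Finset.exists_max_image (Finset.univ.filter fun j => c j ≠ 0)
    (fun j => colDegree A j) ⟨j₀, by simpa using hj₀⟩
  simp only [Finset.mem_filter, Finset.mem_univ, true_and] at hj hmax
  let u : κ → F[X] := fun j => C (c j)
  have hdvd : ∀ i, ∃ q, A.mulVec u i = (X - C a) * q := by
    intro i
    refine dvd_iff_isRoot.mpr ?_
    have := congrFun (eval_mulVec A u a) i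
    simp only [u, eval_C] at this
    rw [IsRoot, this, hc]
    rfl
  choose w hw using hdvd
  have hdeg : ∀ i, (A.mulVec u i).natDegree ≤ colDegree A j := by
    intro i
    refine natDegree_sum_le_of_forall_le _ _ fun t _ => ?_
    by_cases ht : c t = 0
    · simp [u, ht]
    · exact (natDegree_mul_C_le _ _).trans ((natDegree_le_colDegree A i t).trans (hmax t ht))
  have hXa : algebraMap F[X] (RatFunc F) (X - C a) ≠ 0 := by
    rw [Ne, map_eq_zero_iff _ algebraMap_ratFunc_injective]
    exact X_sub_C_ne_zero a
  have hle := hA.colDegree_le (w := w) (j := j)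
    (x := (algebraMap F[X] (RatFunc F) (X - C a))⁻¹ •
      fun t => algebraMap F[X] (RatFunc F) (u t)) (by
      rw [Matrix.mulVec_smul, toRat_mulVec]
      funext i
      simp only [Pi.smul_apply, smul_eq_mul]
      rw [hw i, map_mul, inv_mul_cancel_left₀ hXa]) (by
      simp only [Pi.smul_apply, smul_eq_mul]
      refine mul_ne_zero (inv_ne_zero hXa) ?_
      rw [Ne, map_eq_zero_iff _ algebraMap_ratFunc_injective]
      simpa [u] using hj)
  -- The combination is nonzero, so dividing it by `z - a` lowers its degree strictly.
  have hAu : A.mulVec u ≠ 0 := by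
    intro h0
    have := congrFun (hA.1.mulVec_eq_zero h0) j
    exact hj (by simpa [u] using this)
  have hwdeg : ∀ i, w i ≠ 0 → (w i).natDegree + 1 ≤ colDegree A j := by
    intro i hi
    have := hdeg i
    rw [hw i, natDegree_mul (X_sub_C_ne_zero a) hi, natDegree_X_sub_C] at this
    omega
  obtain ⟨i, hi⟩ := Function.ne_iff.mp hAu
  have hwi : w i ≠ 0 := by
    intro h0
    apply hi
    rw [hw i, h0, mul_zero]
    rfl
  have hpos := hwdeg i hwi
  have hlt : (Finset.univ.sup fun i => (w i).natDegree) < colDegree A j := by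
    rw [Finset.sup_lt_iff (by exact lt_of_lt_of_le (Nat.succ_pos _) hpos)]
    intro i' _
    by_cases h0 : w i' = 0
    · rw [h0, natDegree_zero]; omega
    · have := hwdeg i' h0; omega
  omega

/-- A minimal basis is column reduced: otherwise the leading terms of some columns cancel after
multiplication by powers of `z`, and the resulting combination can be exchanged for a column of
larger degree. -/
theorem IsMinimalBasis.isColumnReduced [Fintype ι] [Fintype κ]
    {S : Submodule (RatFunc F) (ι → RatFunc F)} {A : Matrix ι κ F[X]} (hA : IsMinimalBasis S A) :
    IsColumnReduced A := by
  classical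
  intro c hc
  by_contra hne
  obtain ⟨j₀, hj₀⟩ := Function.ne_iff.mp hne
  obtain ⟨j, hj, hmax⟩ := Finset.exists_max_image (Finset.univ.filter fun j => c j ≠ 0)
    (fun j => colDegree A j) ⟨j₀, by simpa using hj₀⟩
  simp only [Finset.mem_filter, Finset.mem_univ, true_and] at hj hmax
  let u : κ → F[X] := fun t => C (c t) * X ^ (colDegree A j - colDegree A t)
  have huj : u j ≠ 0 := by simpa [u] using hj
  have hdeg : ∀ i, (A.mulVec u i).natDegree ≤ colDegree A j := by
    intro i
    refine natDegree_sum_le_of_forall_le _ _ fun t _ => ?_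
    by_cases ht : c t = 0
    · simp [u, ht]
    · refine (natDegree_mul_le_of_le (natDegree_le_colDegree A i t)
        (natDegree_C_mul_X_pow_le _ _)).trans ?_
      have := hmax t ht
      omega
  have hcoeff : ∀ i, (A.mulVec u i).coeff (colDegree A j) = 0 := by
    intro i
    rw [← Pi.zero_apply (M := fun _ => F) i, ← hc]
    simp only [Matrix.mulVec, dotProduct, finsetSum_coeff]
    refine Finset.sum_congr rfl fun t _ => ?_
    by_cases ht : c t = 0
    · simp [u, ht]
    · have h2 : colDegree A j = colDegree A t + (colDegree A j - colDegree A t) := by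
        have := hmax t ht
        omega
      conv_lhs => rw [h2]
      rw [coeff_mul_add_eq_of_natDegree_le (natDegree_le_colDegree A i t)
        (natDegree_C_mul_X_pow_le _ _)]
      simp [leadingColMatrix]
  have hlt : ∀ i, A.mulVec u i ≠ 0 → (A.mulVec u i).natDegree < colDegree A j := by
    intro i hi
    refine lt_of_le_of_ne (hdeg i) fun h => hi ?_
    rw [← leadingCoeff_eq_zero, leadingCoeff, h, hcoeff i]
  have hAu : A.mulVec u ≠ 0 := fun h0 => huj (congrFun (hA.1.mulVec_eq_zero h0) j)
  obtain ⟨i, hi⟩ := Function.ne_iff.mp hAu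
  have hle := hA.colDegree_le (w := A.mulVec u) (j := j) (toRat_mulVec A u) (by
    rwa [Ne, map_eq_zero_iff _ algebraMap_ratFunc_injective])
  have hpos := hlt i hi
  have : (Finset.univ.sup fun i => (A.mulVec u i).natDegree) < colDegree A j := by
    rw [Finset.sup_lt_iff (lt_of_le_of_lt (Nat.zero_le _) hpos)]
    intro i' _
    by_cases h0 : A.mulVec u i' = 0
    · rw [h0, natDegree_zero]; omega
    · exact hlt i' h0
  omega

end MinimalBasis

/-! ### The kernel of the pencil as a module of solutions modulo a polynomial -/

section Bezout

theorem coeff_divX_iterate {R : Type*} [Semiring R] (q : R[X]) (j i : ℕ) :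
    (divX^[j] q).coeff i = q.coeff (i + j) := by
  induction j generalizing i with
  | zero => rfl
  | succ j ih =>
    rw [Function.iterate_succ_apply', coeff_divX, ih]
    congr 1
    omega

theorem divX_iterate_eq_zero {R : Type*} [Semiring R] {q : R[X]} {j : ℕ} (h : q.natDegree < j) :
    divX^[j] q = 0 := by
  ext i
  rw [coeff_divX_iterate, coeff_zero]
  exact coeff_eq_zero_of_natDegree_lt (by omega)

theorem divX_iterate_eq {R : Type*} [Semiring R] (q : R[X]) (j : ℕ) :
    divX^[j] q = X * divX^[j + 1] q + C (q.coeff j) := by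
  conv_lhs => rw [← X_mul_divX_add (divX^[j] q)]
  rw [← Function.iterate_succ_apply' (f := divX), coeff_divX_iterate, zero_add]

theorem map_divX_iterate {R S : Type*} [Semiring R] [Semiring S] (f : R →+* S) (q : R[X]) (j : ℕ) :
    (divX^[j] q).map f = divX^[j] (q.map f) := by
  ext i
  rw [coeff_map, coeff_divX_iterate, coeff_divX_iterate, coeff_map]

/-- The coefficients in `x` of the Bézoutian `(P(y) Q(x) - P(x) Q(y)) / (x - y)`. They come from
`(Q(x) - Q(y)) / (x - y) = ∑ⱼ xʲ Qⱼ(y)`, where `Qⱼ` is the quotient of `Q(y)` by `y^(j+1)`. -/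
theorem coeff_of_X_sub_C_X_mul_eq {R : Type*} [CommRing R] {P Q : R[X]} {B : R[X][X]}
    (h : (X - C X) * B = C P * Q.map C - P.map C * C Q) (j : ℕ) :
    B.coeff j = P * divX^[j + 1] Q - Q * divX^[j + 1] P := by
  have hN : ∀ j, B.coeff j = X * B.coeff (j + 1) + (P * C (Q.coeff (j + 1))
      - C (P.coeff (j + 1)) * Q) := by
    intro j
    have := congrArg (fun q => q.coeff (j + 1)) h
    simp only [coeff_X_sub_C_mul', coeff_sub, coeff_C_mul, coeff_mul_C, coeff_map] at this
    rw [← this]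
    ring
  -- Both sides satisfy the same recursion and vanish for large `j`.
  have hdown : ∀ d j, B.natDegree + P.natDegree + Q.natDegree ≤ j + d →
      B.coeff j = P * divX^[j + 1] Q - Q * divX^[j + 1] P := by
    intro d
    induction d with
    | zero =>
      intro j hj
      rw [hN j, hN (j + 1), coeff_eq_zero_of_natDegree_lt (n := j + 1 + 1) (by omega),
        coeff_eq_zero_of_natDegree_lt (p := P) (n := j + 1 + 1) (by omega),
        coeff_eq_zero_of_natDegree_lt (p := Q) (n := j + 1 + 1) (by omega),
        coeff_eq_zero_of_natDegree_lt (p := P) (n := j + 1) (by omega),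
        coeff_eq_zero_of_natDegree_lt (p := Q) (n := j + 1) (by omega),
        divX_iterate_eq_zero (q := Q) (by omega), divX_iterate_eq_zero (q := P) (by omega)]
      simp
    | succ d ih =>
      intro j hj
      rw [hN j, ih (j + 1) (by omega), divX_iterate_eq Q (j + 1), divX_iterate_eq P (j + 1)]
      ring
  exact hdown (B.natDegree + P.natDegree + Q.natDegree) j (by omega)

variable {F : Type*} [Field F]

/-- The modulus `(y - z) v(y)`, as a polynomial in `y` over `F(z)`. -/
noncomputable def modulus (v : F[X]) : (RatFunc F)[X] :=
  (X - C (algebraMap F[X] (RatFunc F) X)) * v.map ((algebraMap F[X] (RatFunc F)).comp C)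

/-- `P(y)` as a matrix polynomial in `y` over `F(z)`. -/
noncomputable def liftRat {ι κ : Type*} (P : Matrix ι κ F[X]) : Matrix ι κ (RatFunc F)[X] :=
  P.map (Polynomial.map ((algebraMap F[X] (RatFunc F)).comp C))

theorem coeff_bezoutian (p v : F[X]) (j : ℕ) :
    ((bezoutian p v).coeff j).map (algebraMap F[X] (RatFunc F)) =
      p.map ((algebraMap F[X] (RatFunc F)).comp C) * divX^[j + 1] (modulus v)
        - modulus v * divX^[j + 1] (p.map ((algebraMap F[X] (RatFunc F)).comp C)) := by
  have h : (X - C X) * bezoutian p v = C (p.map C) * ((X - C X) * v.map C : F[X][X]).map C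
      - (p.map C).map C * C ((X - C X) * v.map C) := by
    rw [bezoutian_mul]
    simp only [bezoutNum, inX, inY, Polynomial.map_mul, Polynomial.map_sub, map_X, map_C,
      Polynomial.map_map, C_mul, C_sub]
    ring
  rw [coeff_of_X_sub_C_X_mul_eq h j]
  simp only [Polynomial.map_sub, Polynomial.map_mul, map_divX_iterate, map_X, map_C,
    Polynomial.map_map, modulus]

theorem natDegree_modulus {k : ℕ} (hk : 1 ≤ k) {v : F[X]} (hv : v.natDegree = k - 1)
    (hv0 : v ≠ 0) : (modulus v).natDegree = k := by
  have hinj : Function.Injective ((algebraMap F[X] (RatFunc F)).comp C) :=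
    RingHom.injective _
  rw [modulus, natDegree_mul (X_sub_C_ne_zero _) ((Polynomial.map_ne_zero_iff hinj).mpr hv0),
    natDegree_X_sub_C, natDegree_map_eq_of_injective hinj, hv]
  omega

/-- The `F(z)`-linear map that sends a block vector with blocks `x_b` to `∑_b x_b q_b(y)`, where
`q_b` is the quotient of `(y - z) v(y)` by `y^(k-b)` (zero-based `b`). -/
noncomputable def bezoutMap (k : ℕ) {n : ℕ} (v : F[X]) :
    (Fin k × Fin n → RatFunc F) →ₗ[RatFunc F] (Fin n → (RatFunc F)[X]) where
  toFun x j := ∑ b : Fin k, x (b, j) • divX^[k - 1 - b + 1] (modulus v)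
  map_add' x y := by
    funext j
    simp [add_smul, Finset.sum_add_distrib]
  map_smul' c x := by
    funext j
    simp [mul_smul, Finset.smul_sum]

theorem coeff_bezoutMap {k n : ℕ} (v : F[X]) (x : Fin k × Fin n → RatFunc F) (j : Fin n) (t : ℕ) :
    (bezoutMap k v x j).coeff t =
      ∑ b : Fin k, x (b, j) * (modulus v).coeff (t + (k - 1 - b + 1)) := by
  simp only [bezoutMap, LinearMap.coe_mk, AddHom.coe_mk, finsetSum_coeff, coeff_smul, smul_eq_mul,
    coeff_divX_iterate]

theorem bezoutMap_injective {k n : ℕ} (hk : 1 ≤ k) {v : F[X]} (hv : v.natDegree = k - 1)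
    (hv0 : v ≠ 0) : Function.Injective (bezoutMap k (n := n) v) := by
  classical
  rw [injective_iff_map_eq_zero]
  intro x hx
  have hdeg := natDegree_modulus hk hv hv0
  have hlead : (modulus v).coeff k ≠ 0 := by
    rw [← hdeg]
    refine leadingCoeff_ne_zero.mpr ?_
    rintro h0
    rw [h0, natDegree_zero] at hdeg
    omega
  by_contra hne
  obtain ⟨⟨b₀, j⟩, hb₀⟩ := Function.ne_iff.mp hne
  obtain ⟨b, hb, hmax⟩ := Finset.exists_max_image
    (Finset.univ.filter fun b : Fin k => x (b, j) ≠ 0) id ⟨b₀, by simpa using hb₀⟩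
  simp only [Finset.mem_filter, Finset.mem_univ, true_and, id] at hb hmax
  have hc := coeff_bezoutMap v x j b
  rw [hx, Finset.sum_eq_single b] at hc
  · have : (b : ℕ) + (k - 1 - b + 1) = k := by omega
    rw [this] at hc
    exact mul_ne_zero hb hlead hc.symm
  · intro t _ htb
    by_cases h0 : x (t, j) = 0
    · rw [h0, zero_mul]
    · have h1 : t < b := lt_of_le_of_ne (hmax t h0) htb
      have h2 : (t : ℕ) < b := h1
      rw [coeff_eq_zero_of_natDegree_lt (by omega), mul_zero]
  · simp

theorem degree_bezoutMap_lt {k n : ℕ} (hk : 1 ≤ k) {v : F[X]} (hv : v.natDegree = k - 1)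
    (hv0 : v ≠ 0) (x : Fin k × Fin n → RatFunc F) (j : Fin n) :
    (bezoutMap k v x j).degree < k := by
  have hdeg := natDegree_modulus hk hv hv0
  rw [degree_lt_iff_coeff_zero]
  intro t ht
  rw [coeff_bezoutMap]
  refine Finset.sum_eq_zero fun b _ => ?_
  rw [coeff_eq_zero_of_natDegree_lt (by omega), mul_zero]

/-- An element of the kernel of `DL(P, v)` yields a solution of `P(y) w(y) ≡ 0` modulo
`(y - z) v(y)`. -/
theorem modulus_dvd_of_mem_ratKer {m n k : ℕ} (hk : 1 ≤ k) {P : Matrix (Fin m) (Fin n) F[X]}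
    (hP : ∀ i j, (P i j).natDegree ≤ k) {v : F[X]} (hv : v.natDegree ≤ k - 1)
    {x : Fin k × Fin n → RatFunc F} (hx : x ∈ ratKer (DL k P v)) (i : Fin m) :
    modulus v ∣ (liftRat P).mulVec (bezoutMap k v x) i := by
  set φ := algebraMap F[X] (RatFunc F) with hφ
  have hsum : ∑ c : Fin k × Fin n, x c •
      ((bezoutian (P i c.2) v).coeff (k - 1 - c.1)).map φ = 0 := by
    ext t
    simp only [finsetSum_coeff, coeff_smul, coeff_map, smul_eq_mul, coeff_zero]
    by_cases ht : t < k
    · have h := congrFun (LinearMap.mem_ker.mp hx) (⟨k - 1 - t, by omega⟩, i)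
      rw [Matrix.mulVecLin_apply] at h
      simp only [Matrix.mulVec, dotProduct, toRat, Matrix.map_apply, DL, Pi.zero_apply] at h
      have e : k - 1 - (k - 1 - t) = t := by omega
      rw [e] at h
      rw [← h]
      exact Finset.sum_congr rfl fun c _ => mul_comm _ _
    · refine Finset.sum_eq_zero fun c _ => ?_
      have := natDegree_coeff_bezoutian_lt hk (hP i c.2) hv (k - 1 - c.1)
      rw [coeff_eq_zero_of_natDegree_lt (by omega), map_zero, mul_zero]
  simp only [hφ, coeff_bezoutian, smul_sub, Finset.sum_sub_distrib] at hsum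
  have e : (liftRat P).mulVec (bezoutMap k v x) i = ∑ c : Fin k × Fin n, x c •
      ((P i c.2).map (φ.comp C) * divX^[k - 1 - c.1 + 1] (modulus v)) := by
    rw [Fintype.sum_prod_type, Finset.sum_comm]
    simp only [Matrix.mulVec, dotProduct, bezoutMap, LinearMap.coe_mk, AddHom.coe_mk,
      Finset.mul_sum, mul_smul_comm, liftRat, Matrix.map_apply, hφ]
  rw [e, sub_eq_zero.mp hsum]
  refine Finset.dvd_sum fun c _ => ?_
  rw [← mul_smul_comm]
  exact dvd_mul_right _ _

end Bezout

section Lifting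

variable {K : Type*} [Field K] {ι κ τ : Type*}

/-- If the kernel of `P(a)` is spanned by the columns of `M(a)` at every root `a` of a product
of linear factors, then a solution `w(z)` of `P(z) w(z) ≡ 0` modulo this product is
congruent to a polynomial combination of the columns of `M(z)`. -/
theorem exists_eq_mulVec_add_smul [Fintype κ] [Fintype τ] {P : Matrix ι κ K[X]}
    {M : Matrix κ τ K[X]} (hPM : P * M = 0) (s : Multiset K)
    (hs : ∀ a ∈ s, ∀ u : κ → K, (P.map (Polynomial.eval a)).mulVec u = 0 →
      ∃ c : τ → K, u = (M.map (Polynomial.eval a)).mulVec c)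
    (w : κ → K[X]) (hw : ∀ i, (s.map fun a => X - C a).prod ∣ P.mulVec w i) :
    ∃ (c : τ → K[X]) (q : κ → K[X]), w = M.mulVec c + (s.map fun a => X - C a).prod • q := by
  induction s using Multiset.induction_on generalizing w with
  | empty => exact ⟨0, w, by simp⟩
  | cons a s ih =>
    simp only [Multiset.map_cons, Multiset.prod_cons] at hw ⊢
    have h0 : (P.map (Polynomial.eval a)).mulVec (fun j => (w j).eval a) = 0 := by
      rw [← eval_mulVec]
      funext i
      obtain ⟨q, hq⟩ := hw i
      simp [hq]
    obtain ⟨c, hc⟩ := hs a (Multiset.mem_cons_self a s) _ h0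
    have hdvd : ∀ j, ∃ q, w j - M.mulVec (fun t => C (c t)) j = (X - C a) * q := by
      intro j
      refine dvd_iff_isRoot.mpr ?_
      have h1 := congrFun (eval_mulVec M (fun t => C (c t)) a) j
      simp only [eval_C] at h1
      rw [IsRoot, eval_sub, h1, ← hc, sub_self]
    choose w' hw' using hdvd
    have hww : w = M.mulVec (fun t => C (c t)) + (X - C a) • w' := by
      funext j
      simp only [Pi.add_apply, Pi.smul_apply, smul_eq_mul, ← hw' j]
      ring
    have hw1 : ∀ i, (s.map fun a => X - C a).prod ∣ P.mulVec w' i := by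
      intro i
      have h2 := hw i
      rw [hww, Matrix.mulVec_add, Matrix.mulVec_mulVec, hPM, Matrix.zero_mulVec, zero_add,
        Matrix.mulVec_smul, Pi.smul_apply, smul_eq_mul] at h2
      exact (mul_dvd_mul_iff_left (X_sub_C_ne_zero a)).mp h2
    obtain ⟨c', q, hq⟩ := ih (fun b hb => hs b (Multiset.mem_cons_of_mem hb)) w' hw1
    refine ⟨(fun t => C (c t)) + (X - C a) • c', q, ?_⟩
    conv_lhs => rw [hww, hq]
    rw [smul_add, Matrix.mulVec_add, Matrix.mulVec_smul, smul_smul, add_assoc]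

theorem finrank_le_of_forall_exists_eq_mulVec_add_smul {σ : Type*} [Finite σ] [Fintype τ]
    [Finite κ] (M : Matrix κ τ K[X]) {f : K[X]} (hf : f.Monic) (V : Submodule K (σ → K))
    (T : (σ → K) →ₗ[K] (κ → K[X])) (hT : Function.Injective T)
    (hdeg : ∀ x ∈ V, ∀ j, (T x j).degree < f.natDegree)
    (hV : ∀ x ∈ V, ∃ (c : τ → K[X]) (q : κ → K[X]), T x = M.mulVec c + f • q) :
    Module.finrank K V ≤ Fintype.card τ * f.natDegree := by
  let N := f.natDegree
  have : FiniteDimensional K (degreeLT K N) := (degreeLTEquiv K N).symm.finiteDimensional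
  let R : (τ → degreeLT K N) →ₗ[K] (κ → K[X]) :=
    LinearMap.pi fun j => (modByMonicHom f).comp
      (∑ t, (LinearMap.mulLeft K (M j t)).comp
        ((degreeLT K N).subtype.comp (LinearMap.proj t)))
  have hR : ∀ c j, R c j = (∑ t, M j t * (c t : K[X])) %ₘ f := by
    intro c j
    simp [R, modByMonicHom]
  have hle : V.map T ≤ LinearMap.range R := by
    rintro _ ⟨x, hx, rfl⟩
    obtain ⟨c, q, hcq⟩ := hV x hx
    refine ⟨fun t => ⟨c t %ₘ f, ?_⟩, ?_⟩
    · rw [mem_degreeLT, ← degree_eq_natDegree hf.ne_zero]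
      exact degree_modByMonic_lt _ hf
    · funext j
      rw [hR]
      have h1 : T x j %ₘ f = T x j := by
        rw [modByMonic_eq_self_iff hf, degree_eq_natDegree hf.ne_zero]
        exact hdeg x hx j
      rw [← h1]
      refine (modByMonic_eq_of_dvd_sub hf ?_).symm
      rw [hcq]
      have h2 : (M.mulVec c + f • q) j - ∑ t, M j t * (c t %ₘ f) =
          f * (q j + ∑ t, M j t * (c t /ₘ f)) := by
        simp only [Pi.add_apply, Pi.smul_apply, smul_eq_mul, Matrix.mulVec, dotProduct, mul_add,
          Finset.mul_sum]
        rw [add_sub_right_comm, ← Finset.sum_sub_distrib, add_comm]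
        congr 1
        refine Finset.sum_congr rfl fun t _ => ?_
        linear_combination -(M j t) * modByMonic_add_div (c t) f
      rw [h2]
      exact dvd_mul_right _ _
  calc Module.finrank K V = Module.finrank K (V.map T) :=
        (LinearEquiv.finrank_eq (Submodule.equivMapOfInjective T hT V))
    _ ≤ Module.finrank K (LinearMap.range R) := Submodule.finrank_mono hle
    _ ≤ Module.finrank K (τ → degreeLT K N) := LinearMap.finrank_range_le R
    _ = Fintype.card τ * f.natDegree := by
        rw [Module.finrank_pi_fintype]
        simp [(degreeLTEquiv K N).finrank_eq, N]

/-- Exactness of a pair of matrices is preserved by extensions of the field. -/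
theorem exists_eq_map_mulVec {F : Type*} [Field F] (f : F →+* K) [Fintype ι] [Fintype κ]
    [Fintype τ] {A : Matrix ι κ F} {B : Matrix κ τ F}
    (h : ∀ u : κ → F, A.mulVec u = 0 → ∃ c, u = B.mulVec c) (u : κ → K)
    (hu : (A.map f).mulVec u = 0) : ∃ c, u = (B.map f).mulVec c := by
  classical
  obtain ⟨g, hg⟩ := A.mulVecLin.rangeRestrict.exists_rightInverse_of_surjective
    A.mulVecLin.range_rangeRestrict
  obtain ⟨G, hG⟩ := g.exists_extend
  -- `N` is a generalized inverse of `A`, hence `1 - N * A` factors through `B`.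
  let N : Matrix κ ι F := LinearMap.toMatrix' G
  have hANA : ∀ y, A.mulVec (N.mulVec (A.mulVec y)) = A.mulVec y := by
    intro y
    have h1 : N.mulVec (A.mulVec y) = G (A.mulVec y) := LinearMap.toMatrix'_mulVec _ _
    have h2 : G (A.mulVec y) = g (A.mulVecLin.rangeRestrict y) :=
      LinearMap.congr_fun hG (A.mulVecLin.rangeRestrict y)
    have h3 := congrArg Subtype.val (LinearMap.congr_fun hg (A.mulVecLin.rangeRestrict y))
    rw [h1, h2]
    exact h3
  have hcol : ∀ j : κ, ∃ c : τ → F, (1 - N * A).mulVec (Pi.single j 1) = B.mulVec c := by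
    intro j
    apply h
    rw [Matrix.sub_mulVec, Matrix.mulVec_sub, Matrix.one_mulVec, ← Matrix.mulVec_mulVec, hANA,
      sub_self]
  choose c hc using hcol
  let Q : Matrix τ κ F := fun t j => c j t
  have hfac : (1 : Matrix κ κ F) = N * A + B * Q := by
    rw [← sub_eq_iff_eq_add']
    ext1 i j
    have := congrFun (hc j) i
    rw [Matrix.mulVec_single_one] at this
    exact this
  have hfac' : (1 : Matrix κ κ K) = N.map f * A.map f + B.map f * Q.map f := by
    rw [← Matrix.map_mul, ← Matrix.map_mul, ← Matrix.map_add f (map_add f), ← hfac,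
      Matrix.map_one f (map_zero f) (map_one f)]
  refine ⟨(Q.map f).mulVec u, ?_⟩
  conv_lhs => rw [← Matrix.one_mulVec u, hfac']
  rw [Matrix.add_mulVec, ← Matrix.mulVec_mulVec, hu, Matrix.mulVec_zero, zero_add,
    Matrix.mulVec_mulVec]

end Lifting

/-! ### The dimension of the kernel of the pencil -/

section KernelDimension

variable {F : Type*} [Field F] {m n p : ℕ}

theorem IsPolynomialBasis.mul_eq_zero {P : Matrix (Fin m) (Fin n) F[X]}
    {M : Matrix (Fin n) (Fin p) F[X]} (hM : IsPolynomialBasis (ratKer P) M) : P * M = 0 := by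
  apply toRat_injective
  rw [toRat_mul]
  ext i j
  have h1 : (toRat M).col j ∈ ratKer P := by
    rw [← hM.2]
    exact Submodule.subset_span ⟨j, rfl⟩
  have h2 := congrFun (LinearMap.mem_ker.mp h1) i
  rw [Matrix.mulVecLin_apply] at h2
  refine Eq.trans h2 ?_
  simp [toRat]

/-- At a point that is not an eigenvalue, a basis of `ker P(z)` of full column rank spans the
kernel of the value of `P(z)`. -/
theorem exists_eq_eval_mulVec {P : Matrix (Fin m) (Fin n) F[X]}
    {M : Matrix (Fin n) (Fin p) F[X]} (hM : IsPolynomialBasis (ratKer P) M)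
    (hfull : HasFullColRank M) {a : F} (ha : ¬ IsEigenvalue P a) (u : Fin n → F)
    (hu : (P.map (Polynomial.eval a)).mulVec u = 0) :
    ∃ c, u = (M.map (Polynomial.eval a)).mulVec c := by
  have hle : LinearMap.range (M.map (Polynomial.eval a)).mulVecLin ≤
      LinearMap.ker (P.map (Polynomial.eval a)).mulVecLin := by
    rintro _ ⟨c, rfl⟩
    rw [LinearMap.mem_ker, Matrix.mulVecLin_apply, Matrix.mulVecLin_apply, Matrix.mulVec_mulVec]
    have : P.map (Polynomial.eval a) * M.map (Polynomial.eval a) =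
        (P * M).map (Polynomial.eval a) := (Matrix.map_mul (f := evalRingHom a)).symm
    rw [this, hM.mul_eq_zero]
    ext i
    simp [Matrix.mulVec, dotProduct]
  have h1 : Module.finrank F (LinearMap.range (M.map (Polynomial.eval a)).mulVecLin) = p := by
    rw [LinearMap.finrank_range_of_inj]
    · simp
    · rw [injective_iff_map_eq_zero]
      exact hfull a
  have h2 := LinearMap.finrank_range_add_finrank_ker (P.map (Polynomial.eval a)).mulVecLin
  have h3 := LinearMap.finrank_range_add_finrank_ker (toRat P).mulVecLin
  have h4 : Module.finrank (RatFunc F) (LinearMap.ker (toRat P).mulVecLin) = p := by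
    change Module.finrank (RatFunc F) (ratKer P) = p
    rw [← hM.2, finrank_span_eq_card hM.1, Fintype.card_fin]
  simp only [IsEigenvalue, Matrix.rank, not_lt] at ha
  simp only [Module.finrank_fintype_fun_eq_card] at h2 h3
  have heq := Submodule.eq_of_le_of_finrank_le hle (by omega)
  have hmem : u ∈ LinearMap.ker (P.map (Polynomial.eval a)).mulVecLin := hu
  rw [← heq] at hmem
  obtain ⟨c, hc⟩ := hmem
  exact ⟨c, hc.symm⟩

theorem liftRat_map_eval {ι κ : Type*} (P : Matrix ι κ F[X]) :
    (liftRat P).map (Polynomial.eval (algebraMap F[X] (RatFunc F) X)) = toRat P := by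
  ext i j
  simp only [liftRat, toRat, Matrix.map_apply, eval_map]
  rw [← hom_eval₂, eval₂_C_X]

theorem liftRat_map_eval_C {ι κ : Type*} (P : Matrix ι κ F[X]) (a : F) :
    (liftRat P).map (Polynomial.eval (algebraMap F[X] (RatFunc F) (C a))) =
      (P.map (Polynomial.eval a)).map ((algebraMap F[X] (RatFunc F)).comp C) := by
  ext i j
  simp only [liftRat, Matrix.map_apply]
  exact eval_map_apply (f := (algebraMap F[X] (RatFunc F)).comp C) a

/-- If no root of `v` is an eigenvalue of `P(z)`, the kernel of `DL(P, v)` has dimension at most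
`k p`. -/
theorem finrank_ratKer_DL_le [IsAlgClosed F] {k : ℕ} (hk : 1 ≤ k)
    {P : Matrix (Fin m) (Fin n) F[X]} (hP : ∀ i j, (P i j).natDegree ≤ k) {v : F[X]}
    (hv : v.natDegree = k - 1) (hv0 : v ≠ 0) {M : Matrix (Fin n) (Fin p) F[X]}
    (hM : IsPolynomialBasis (ratKer P) M) (hfull : HasFullColRank M)
    (hdisj : ∀ a, v.IsRoot a → ¬ IsEigenvalue P a) :
    Module.finrank (RatFunc F) (ratKer (DL k P v)) ≤ p * k := by
  set φ := algebraMap F[X] (RatFunc F) with hφ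
  let s : Multiset (RatFunc F) := φ X ::ₘ v.roots.map fun a => φ (C a)
  set f : (RatFunc F)[X] := (s.map fun a => X - C a).prod with hf
  have hfmonic : f.Monic := monic_multisetProd_X_sub_C s
  have hmod : modulus v = C (φ (C v.leadingCoeff)) * f := by
    have hsplit := (IsAlgClosed.splits v).eq_prod_roots
    rw [modulus]
    conv_lhs => rw [hsplit]
    simp only [hf, s, Multiset.map_cons, Multiset.prod_cons, Polynomial.map_mul, map_C,
      Polynomial.map_multiset_prod, Multiset.map_map, Function.comp_def, Polynomial.map_sub, map_X,
      RingHom.comp_apply]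
    ring
  have hc : φ (C v.leadingCoeff) ≠ 0 := by
    rw [Ne, map_eq_zero_iff _ algebraMap_ratFunc_injective, C_eq_zero]
    exact leadingCoeff_ne_zero.mpr hv0
  have hdeg : f.natDegree = k := by
    rw [← natDegree_modulus hk hv hv0, hmod, natDegree_C_mul hc]
  have hPM : liftRat P * liftRat M = 0 := by
    have : liftRat P * liftRat M = liftRat (P * M) :=
      (Matrix.map_mul (f := mapRingHom (φ.comp C))).symm
    rw [this, hM.mul_eq_zero]
    ext1 i j
    simp [liftRat]
  have hs : ∀ a ∈ s, ∀ u, ((liftRat P).map (Polynomial.eval a)).mulVec u = 0 →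
      ∃ c, u = ((liftRat M).map (Polynomial.eval a)).mulVec c := by
    intro a ha u hu
    rcases Multiset.mem_cons.mp ha with rfl | ha
    · rw [liftRat_map_eval] at hu ⊢
      have hmem : u ∈ ratKer P := hu
      rw [← hM.2, ← Matrix.range_mulVecLin] at hmem
      obtain ⟨c, hc⟩ := hmem
      exact ⟨c, hc.symm⟩
    · obtain ⟨b, hb, rfl⟩ := Multiset.mem_map.mp ha
      rw [liftRat_map_eval_C] at hu ⊢
      exact exists_eq_map_mulVec _
        (exists_eq_eval_mulVec hM hfull (hdisj b (isRoot_of_mem_roots hb))) u hu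
  have := finrank_le_of_forall_exists_eq_mulVec_add_smul (liftRat M) hfmonic (ratKer (DL k P v))
    (bezoutMap k v) (bezoutMap_injective hk hv hv0)
    (fun x _ j => by rw [hdeg]; exact degree_bezoutMap_lt hk hv hv0 x j)
    (fun x hx => exists_eq_mulVec_add_smul hPM s hs _ fun i => by
      refine (Dvd.intro_left _ hmod.symm).trans ?_
      exact modulus_dvd_of_mem_ratKer hk hP hv.le hx i)
  rwa [Fintype.card_fin, hdeg] at this

end KernelDimension

/-! ### Kernel vectors of the pencil -/

section KernelVectors

variable {F : Type*} [Field F] {m n p : ℕ}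

theorem inX_mul (f g : F[X]) : inX (f * g) = inX f * inX g := Polynomial.map_mul _

theorem eval_inX_X (f : F[X]) : (inX f).eval (X : F[X][X]) = f.map C := by
  rw [inX, ← Polynomial.map_map, eval_map, eval₂_C_X]

theorem eval_inX_C (f : F[X]) (g : F[X]) :
    (inX f).eval (C g : F[X][X]) = C (f.eval₂ C g) := by
  rw [inX, eval_map, hom_eval₂]

theorem sum_mul_sub_mul {R ι : Type*} [CommRing R] [Fintype ι] (g y x : ι → R) (a b : R) :
    ∑ j, g j * (y j * a - x j * b) = (∑ j, g j * y j) * a - (∑ j, g j * x j) * b := by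
  rw [Finset.sum_mul, Finset.sum_mul, ← Finset.sum_sub_distrib]
  exact Finset.sum_congr rfl fun j _ => by ring

/-- For `P g = 0`, the Bézoutian applied to `g(x)` is divisible by `(x - z) v(x)`: only the first
term of its numerator remains, and the factor `P(y) g(x)` of this term vanishes for `x = y`. -/
theorem dvd_sum_inX_mul_bezoutian {P : Matrix (Fin m) (Fin n) F[X]} {g : Fin n → F[X]}
    (hg : P.mulVec g = 0) (v : F[X]) (i : Fin m) :
    (X - C (C X)) * inX v ∣ ∑ j, inX (g j) * bezoutian (P i j) v := by
  have hsum : ∑ j, g j * P i j = 0 := by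
    rw [← Pi.zero_apply (M := fun _ => F[X]) i, ← hg]
    exact Finset.sum_congr rfl fun j _ => mul_comm _ _
  have hroot : (∑ j, inX (g j) * inY (P i j)).IsRoot X := by
    rw [IsRoot, eval_finsetSum]
    simp only [eval_mul, eval_inX_X, inY, eval_C, ← Polynomial.map_mul]
    rw [← Polynomial.map_sum, hsum, Polynomial.map_zero]
  obtain ⟨R, hR⟩ := dvd_iff_isRoot.mpr hroot
  refine ⟨R, mul_left_cancel₀ (X_sub_C_ne_zero (X : F[X][X])) ?_⟩
  have h0 : ∑ j, inX (g j) * inX (P i j) = 0 := by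
    simp only [← inX_mul]
    unfold inX
    rw [← Polynomial.map_sum, hsum, Polynomial.map_zero]
  calc (X - C X) * ∑ j, inX (g j) * bezoutian (P i j) v
      = ∑ j, inX (g j) * bezoutNum (P i j) v := by
        rw [Finset.mul_sum]
        refine Finset.sum_congr rfl fun j _ => ?_
        rw [← bezoutian_mul]
        ring
    _ = (∑ j, inX (g j) * inY (P i j)) * ((X - C (C X)) * inX v)
          - (∑ j, inX (g j) * inX (P i j)) * ((C X - C (C X)) * inY v) := by
        refine Eq.trans (Finset.sum_congr rfl fun j _ => ?_)
          (sum_mul_sub_mul (fun j => inX (g j)) (fun j => inY (P i j)) (fun j => inX (P i j)) _ _)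
        rw [bezoutNum]
        ring
    _ = (X - C X) * ((X - C (C X)) * inX v * R) := by
        rw [hR, h0]
        ring

theorem sum_inX_mul_bezoutian {k : ℕ} (hk : 1 ≤ k) {P : Matrix (Fin m) (Fin n) F[X]}
    (hP : ∀ i j, (P i j).natDegree ≤ k) {v : F[X]} (hv : v.natDegree ≤ k - 1)
    (g : Fin n → F[X]) (i : Fin m) :
    ∑ j, inX (g j) * bezoutian (P i j) v = ∑ c : Fin k × Fin n,
      C ((bezoutian (P i c.2) v).coeff (k - 1 - c.1)) * inX (X ^ (k - 1 - (c.1 : ℕ)) * g c.2) := by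
  rw [Fintype.sum_prod_type, Finset.sum_comm]
  refine Finset.sum_congr rfl fun j _ => ?_
  conv_lhs => rw [(bezoutian (P i j) v).as_sum_range_C_mul_X_pow'
    (natDegree_bezoutian_lt hk (hP i j) hv)]
  rw [← Finset.sum_range_reflect, Finset.sum_range, Finset.mul_sum]
  refine Finset.sum_congr rfl fun b _ => ?_
  have : inX (X ^ (k - 1 - (b : ℕ)) : F[X]) = X ^ (k - 1 - (b : ℕ)) := by simp [inX]
  rw [inX_mul, this]
  ring

theorem DL_mul_matD {k : ℕ} (hk : 1 ≤ k) {P : Matrix (Fin m) (Fin n) F[X]}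
    (hP : ∀ i j, (P i j).natDegree ≤ k) {v : F[X]} (hv : v.natDegree ≤ k - 1)
    {M : Matrix (Fin n) (Fin p) F[X]} (hPM : P * M = 0) : DL k P v * matD k M = 0 := by
  ext1 r j
  have hg : P.mulVec (fun i => M i j) = 0 := funext fun i => congrFun (congrFun hPM i) j
  obtain ⟨R, hR⟩ := dvd_sum_inX_mul_bezoutian hg v r.2
  rw [sum_inX_mul_bezoutian hk hP hv] at hR
  have h1 := congrArg (fun q => (q.eval (C X : F[X][X])).coeff (k - 1 - r.1)) hR
  simp only [eval_finsetSum, eval_mul, eval_C, eval_sub, eval_X, sub_self, zero_mul,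
    coeff_zero, eval_inX_C, eval₂_C_X, finsetSum_coeff, coeff_mul_C] at h1
  exact h1

theorem eval_iterate_derivative_eq_zero_of_dvd {R : Type*} [CommRing R] {a : R} {l b : ℕ}
    (hb : b < l) {q : R[X]} (h : (X - C a) ^ l ∣ q) : (derivative^[b] q).eval a = 0 := by
  have h1 := pow_sub_dvd_iterate_derivative_of_pow_dvd b h
  have h2 : (X - C a) ∣ derivative^[b] q := (dvd_pow_self _ (by omega)).trans h1
  exact dvd_iff_isRoot.mp h2

theorem DL_mul_matC {k s : ℕ} (hk : 1 ≤ k) {P : Matrix (Fin m) (Fin n) F[X]}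
    (hP : ∀ i j, (P i j).natDegree ≤ k) {v : F[X]} (hv : v.natDegree ≤ k - 1)
    {M : Matrix (Fin n) (Fin p) F[X]} (hPM : P * M = 0) {μ : Fin s → F} {l : Fin s → ℕ}
    (hl : ∀ t, (X - C (μ t)) ^ l t ∣ v) : DL k P v * (matC k M μ l).map C = 0 := by
  ext1 r c
  obtain ⟨⟨t, a⟩, j⟩ := c
  have hg : P.mulVec (fun i => M i j) = 0 := funext fun i => congrFun (congrFun hPM i) j
  have hdvd : (X - C (C (C (μ t)))) ^ l t ∣
      ∑ j', inX (M j' j) * bezoutian (P r.2 j') v := by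
    have h1 : (X - C (C (C (μ t)))) ^ l t ∣ inX v := by
      have := map_dvd (mapRingHom ((C : F[X] →+* F[X][X]).comp (C : F →+* F[X]))) (hl t)
      simpa [inX] using this
    obtain ⟨q, hq⟩ := h1
    obtain ⟨R, hR⟩ := dvd_sum_inX_mul_bezoutian hg v r.2
    refine ⟨(X - C (C X)) * q * R, ?_⟩
    rw [hR, hq]
    ring
  rw [sum_inX_mul_bezoutian hk hP hv] at hdvd
  have h0 := eval_iterate_derivative_eq_zero_of_dvd a.2 hdvd
  have h1 := congrArg (fun q => q.coeff (k - 1 - r.1)) h0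
  simp only [iterate_derivative_sum, iterate_derivative_C_mul, inX, iterate_derivative_map] at h1
  simp only [← inX.eq_1, eval_finsetSum, eval_mul, eval_C, eval_inX_C, finsetSum_coeff,
    coeff_mul_C, coeff_zero] at h1
  rw [Matrix.mul_apply, Matrix.zero_apply, ← h1]
  refine Finset.sum_congr rfl fun c _ => ?_
  rw [eval₂_at_apply]
  rfl

end KernelVectors

/-! ### Interpolation at the roots of the ansatz polynomial -/

section Interpolation

variable {F : Type*} [Field F] {s : ℕ} {μ : Fin s → F} {l : Fin s → ℕ} {v : F[X]}

theorem sum_rootMultiplicity [IsAlgClosed F] (hv0 : v ≠ 0) (hμ : Function.Injective μ)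
    (hroots : Set.range μ = {a : F | v.IsRoot a}) (hl : ∀ t, l t = v.rootMultiplicity (μ t)) :
    ∑ t, l t = v.natDegree := by
  classical
  have h1 : v.roots.toFinset = Finset.univ.image μ := by
    ext a
    rw [Multiset.mem_toFinset, mem_roots hv0]
    have : a ∈ Set.range μ ↔ v.IsRoot a := by rw [hroots]; rfl
    simpa using this.symm
  rw [← IsAlgClosed.card_roots_eq_natDegree, ← Multiset.toFinset_sum_count_eq, h1,
    Finset.sum_image hμ.injOn]
  exact Finset.sum_congr rfl fun t _ => by rw [hl t, count_roots]

theorem prod_X_sub_C_pow_dvd [CharZero F] (hμ : Function.Injective μ) {q : F[X]}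
    (h : ∀ j : Σ t : Fin s, Fin (l t), (derivative^[(j.2 : ℕ)] q).eval (μ j.1) = 0) :
    (∏ t, (X - C (μ t)) ^ l t) ∣ q := by
  rcases eq_or_ne q 0 with rfl | hne
  · exact dvd_zero _
  refine Finset.prod_dvd_of_coprime ?_ ?_
  · intro a _ b _ hab
    exact (isCoprime_X_sub_C_of_isUnit_sub (sub_ne_zero.mpr (hμ.ne hab)).isUnit).pow
  · intro t _
    rw [← le_rootMultiplicity_iff hne]
    by_contra hlt
    push Not at hlt
    exact lt_irrefl _ ((lt_rootMultiplicity_iff_isRoot_iterate_derivative hne).mpr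
      fun b hb => h ⟨t, ⟨b, lt_of_le_of_lt hb hlt⟩⟩)

theorem dvd_of_iterate_derivative_eq_zero [CharZero F] (hv0 : v ≠ 0) (hμ : Function.Injective μ)
    (hl : ∀ t, (X - C (μ t)) ^ l t ∣ v) (hsum : ∑ t, l t = v.natDegree) {q : F[X]}
    (h : ∀ j : Σ t : Fin s, Fin (l t), (derivative^[(j.2 : ℕ)] q).eval (μ j.1) = 0) : v ∣ q := by
  refine dvd_trans ?_ (prod_X_sub_C_pow_dvd hμ h)
  have hdvd : (∏ t, (X - C (μ t)) ^ l t) ∣ v := prod_X_sub_C_pow_dvd hμ fun j =>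
    eval_iterate_derivative_eq_zero_of_dvd j.2.2 (hl j.1)
  have hdeg : (∏ t, (X - C (μ t)) ^ l t).natDegree = v.natDegree := by
    rw [natDegree_prod_of_monic _ _ fun t _ => (monic_X_sub_C _).pow _, ← hsum]
    simp
  have hne : (∏ t, (X - C (μ t)) ^ l t) ≠ 0 := ne_zero_of_dvd_ne_zero hv0 hdvd
  exact (associated_of_dvd_of_natDegree_le hdvd hv0 hdeg.ge).symm.dvd

theorem eval_iterate_derivative_X_sub_C_pow_mul {R : Type*} [CommRing R] (a : R) (n : ℕ)
    (h : R[X]) :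
    (derivative^[n] ((X - C a) ^ n * h)).eval a = n.factorial * h.eval a := by
  have h1 : (taylor a ((X - C a) ^ n * h)).coeff n = h.eval a := by
    rw [taylor_mul, taylor_pow, map_sub, taylor_X, taylor_C, add_sub_cancel_right,
      coeff_X_pow_mul', if_pos le_rfl, Nat.sub_self, taylor_coeff_zero]
  rw [taylor_coeff] at h1
  rw [← factorial_smul_hasseDeriv, ← h1]
  simp

variable {n p k : ℕ} {M : Matrix (Fin n) (Fin p) F[X]}

/-- The coefficient row of a polynomial `q(z)` of degree less than `k`, applied to the block rows
of `D(z)`, gives `q(z) M(z)`. -/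
theorem sum_coeff_mul_matD {q : F[X]} (hq : q.natDegree < k) (i : Fin n) (j : Fin p) :
    ∑ b : Fin k, C (q.coeff (k - 1 - b)) * matD k M (b, i) j = q * M i j := by
  conv_rhs => rw [q.as_sum_range_C_mul_X_pow' hq]
  rw [← Finset.sum_range_reflect, Finset.sum_range, Finset.sum_mul]
  exact Finset.sum_congr rfl fun b _ => by rw [matD, mul_assoc]

theorem sum_coeff_mul_matC {q : F[X]} (hq : q.natDegree < k) (i : Fin n)
    (c : (Σ t : Fin s, Fin (l t)) × Fin p) :
    ∑ b : Fin k, q.coeff (k - 1 - b) * matC k M μ l (b, i) c =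
      (derivative^[(c.1.2 : ℕ)] (q * M i c.2)).eval (μ c.1.1) := by
  rw [← sum_coeff_mul_matD hq i c.2, iterate_derivative_sum, eval_finsetSum]
  refine Finset.sum_congr rfl fun b _ => ?_
  rw [iterate_derivative_C_mul, eval_mul, eval_C]
  rfl

/-- The matrix `C` has full column rank even without its first block row. A combination of its
columns that vanishes on the other block rows is tested against the polynomials that vanish to the
order `ℓₜ` at all nodes but one, and to an arbitrary smaller order at the remaining node; they have
degree at most `k - 2`. -/
theorem eq_zero_of_matC_mulVec_eq_zero [CharZero F] (hμ : Function.Injective μ)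
    (hsum : ∑ t, l t ≤ k - 1) (hM : HasFullColRank M)
    {c : (Σ t : Fin s, Fin (l t)) × Fin p → F}
    (hc : ∀ b : Fin k, (b : ℕ) ≠ 0 → ∀ i, (matC k M μ l).mulVec c (b, i) = 0) : c = 0 := by
  classical
  have htest : ∀ q : F[X], q.natDegree < k - 1 → ∀ i,
      ∑ x, (derivative^[(x.1.2 : ℕ)] (q * M i x.2)).eval (μ x.1.1) * c x = 0 := by
    intro q hq i
    calc ∑ x, (derivative^[(x.1.2 : ℕ)] (q * M i x.2)).eval (μ x.1.1) * c x
        = ∑ x, (∑ b : Fin k, q.coeff (k - 1 - b) * matC k M μ l (b, i) x) * c x :=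
          Finset.sum_congr rfl fun x _ => by rw [sum_coeff_mul_matC (by omega)]
      _ = ∑ b : Fin k, q.coeff (k - 1 - b) * (matC k M μ l).mulVec c (b, i) := by
          simp only [Finset.sum_mul, Matrix.mulVec, dotProduct, Finset.mul_sum]
          rw [Finset.sum_comm]
          exact Finset.sum_congr rfl fun b _ => Finset.sum_congr rfl fun x _ => mul_assoc _ _ _
      _ = 0 := Finset.sum_eq_zero fun b _ => by
          by_cases hb : (b : ℕ) = 0
          · rw [coeff_eq_zero_of_natDegree_lt (by omega), zero_mul]
          · rw [hc b hb i, mul_zero]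
  by_contra hne
  obtain ⟨⟨⟨t, a₀⟩, j₀⟩, hx⟩ := Function.ne_iff.mp hne
  obtain ⟨a, ha, hmax⟩ := Finset.exists_max_image
    (Finset.univ.filter fun a : Fin (l t) => ∃ j, c (⟨t, a⟩, j) ≠ 0) id
    ⟨a₀, by simpa using ⟨j₀, hx⟩⟩
  simp only [Finset.mem_filter, Finset.mem_univ, true_and, id] at ha hmax
  let h : F[X] := ∏ t' ∈ Finset.univ.erase t, (X - C (μ t')) ^ l t'
  let q : F[X] := (X - C (μ t)) ^ (a : ℕ) * h
  have hq : q.natDegree < k - 1 := by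
    have h1 : h.natDegree = ∑ t' ∈ Finset.univ.erase t, l t' := by
      rw [natDegree_prod_of_monic _ _ fun t _ => (monic_X_sub_C _).pow _]
      simp
    have h2 : q.natDegree ≤ a + h.natDegree := by
      refine natDegree_mul_le.trans ?_
      simp
    have h3 := Finset.add_sum_erase _ l (Finset.mem_univ t)
    have h4 := a.2
    omega
  have hother : ∀ t', t' ≠ t → (X - C (μ t')) ^ l t' ∣ q := fun t' ht' =>
    (Finset.dvd_prod_of_mem _ (Finset.mem_erase.mpr ⟨ht', Finset.mem_univ t'⟩)).mul_left _
  have hh : h.eval (μ t) ≠ 0 := by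
    rw [eval_prod]
    refine Finset.prod_ne_zero_iff.mpr fun t' ht' => ?_
    rw [eval_pow, eval_sub, eval_X, eval_C]
    exact pow_ne_zero _ (sub_ne_zero.mpr (hμ.ne (Finset.ne_of_mem_erase ht').symm))
  have hzero : (M.map (Polynomial.eval (μ t))).mulVec (fun j => c (⟨t, a⟩, j)) = 0 := by
    funext i
    have h1 := htest q hq i
    rw [Fintype.sum_prod_type, Finset.sum_eq_single ⟨t, a⟩] at h1
    · have h2 : ∀ j, (derivative^[(a : ℕ)] (q * M i j)).eval (μ t) =
          ((a : ℕ).factorial * h.eval (μ t)) * (M i j).eval (μ t) := by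
        intro j
        rw [mul_assoc ((X - C (μ t)) ^ (a : ℕ)), eval_iterate_derivative_X_sub_C_pow_mul, eval_mul,
          mul_assoc]
      simp only [h2, mul_assoc] at h1
      rw [← Finset.mul_sum, ← Finset.mul_sum] at h1
      have hfac : ((a : ℕ).factorial : F) ≠ 0 := Nat.cast_ne_zero.mpr (Nat.factorial_ne_zero _)
      have h3 : ∑ j, (M i j).eval (μ t) * c (⟨t, a⟩, j) = 0 := by simpa [hfac, hh] using h1
      exact h3
    · rintro ⟨t', a'⟩ - hne'
      refine Finset.sum_eq_zero fun j _ => ?_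
      by_cases ht : t' = t
      · subst ht
        rcases lt_trichotomy (a' : ℕ) (a : ℕ) with hlt | heq | hgt
        · rw [eval_iterate_derivative_eq_zero_of_dvd hlt
            ((dvd_mul_right _ _).trans (dvd_mul_right _ _)), zero_mul]
        · exact absurd (by rw [Fin.ext heq]) hne'
        · have : c (⟨t', a'⟩, j) = 0 := by
            by_contra hcne
            have := hmax a' ⟨j, hcne⟩
            exact absurd hgt (not_lt.mpr this)
          rw [this, mul_zero]
      · rw [eval_iterate_derivative_eq_zero_of_dvd a'.2 ((hother t' ht).trans (dvd_mul_right _ _)),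
          zero_mul]
    · simp
  obtain ⟨j, hj⟩ := ha
  exact hj (congrFun (hM (μ t) _ hzero) j)

/-- `E(z)` is divisible by `v(z)`, because it vanishes to the order `ℓₜ` at every root `μₜ`. -/
theorem dvd_matE [CharZero F] (hv0 : v ≠ 0) (hμ : Function.Injective μ)
    (hl : ∀ t, (X - C (μ t)) ^ l t ∣ v) (hsum : ∑ t, l t = v.natDegree) (r : Fin k × Fin n)
    (j : Fin p) : v ∣ matE k M μ l r j := by
  refine dvd_of_iterate_derivative_eq_zero hv0 hμ hl hsum fun x => ?_
  rw [matE, iterate_derivative_sub, iterate_derivative_sum, eval_sub, eval_finsetSum, sub_eq_zero,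
    Finset.sum_eq_single x]
  · rw [mul_comm, iterate_derivative_C_mul, eval_mul, (hermitePoly_spec hμ l x).2 x, if_pos rfl,
      eval_C, mul_one]
    rfl
  · intro y _ hyx
    rw [mul_comm, iterate_derivative_C_mul, eval_mul, (hermitePoly_spec hμ l y).2 x,
      if_neg hyx.symm, mul_zero]
  · simp

end Interpolation

/-! ### Degrees and ranks of the matrix `F(z)` -/

section ColumnDegrees

variable {F : Type*} [Field F] {s n p k : ℕ} {μ : Fin s → F} {l : Fin s → ℕ}
  {v : F[X]} {M : Matrix (Fin n) (Fin p) F[X]}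

theorem natDegree_matD_le (r : Fin k × Fin n) (j : Fin p) :
    (matD k M r j).natDegree ≤ k - 1 - r.1 + colDegree M j :=
  natDegree_mul_le_of_le (natDegree_X_pow_le _) (natDegree_le_colDegree M r.2 j)

theorem IsColumnReduced.exists_coeff_ne_zero {ι κ : Type*} [Fintype ι] [Fintype κ]
    {A : Matrix ι κ F[X]} (hA : IsColumnReduced A) (j : κ) : ∃ i, leadingColMatrix A i j ≠ 0 := by
  classical
  by_contra hno
  push Not at hno
  have h := hA (Pi.single j 1) (by
    rw [Matrix.mulVec_single_one]
    exact funext hno)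
  have := congrFun h j
  simp at this

theorem colDegree_fromCols_inl {ι κ τ : Type*} [Fintype ι] (B : Matrix ι κ F) (G : Matrix ι τ F[X])
    (c : κ) : colDegree (Matrix.fromCols (B.map C) G) (Sum.inl c) = 0 := by
  simp [colDegree]

theorem colDegree_fromCols_inr {ι κ τ : Type*} [Fintype ι] (B : Matrix ι κ F[X])
    (G : Matrix ι τ F[X]) (j : τ) :
    colDegree (Matrix.fromCols B G) (Sum.inr j) = colDegree G j := rfl

variable [CharZero F]

theorem coeff_hermitePoly_eq_zero (hμ : Function.Injective μ) (i : Σ t : Fin s, Fin (l t)) {d : ℕ}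
    (hd : ∑ t, l t ≤ d) : (hermitePoly μ l i).coeff d = 0 :=
  coeff_eq_zero_of_degree_lt
    ((hermitePoly_spec hμ l i).1.trans_le (by exact_mod_cast hd))

theorem coeff_matE (hμ : Function.Injective μ) {d : ℕ} (hd : ∑ t, l t ≤ d) (r : Fin k × Fin n)
    (j : Fin p) : (matE k M μ l r j).coeff d = (matD k M r j).coeff d := by
  rw [matE, coeff_sub, finsetSum_coeff, Finset.sum_eq_zero, sub_zero]
  intro i _
  rw [coeff_mul_C, coeff_hermitePoly_eq_zero hμ i hd, zero_mul]

theorem natDegree_matE_le (hμ : Function.Injective μ) (hsum : ∑ t, l t = k - 1)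
    (r : Fin k × Fin n) (j : Fin p) :
    (matE k M μ l r j).natDegree ≤ k - 1 + colDegree M j := by
  rw [natDegree_le_iff_coeff_eq_zero]
  intro d hd
  rw [coeff_matE hμ (by omega)]
  refine coeff_eq_zero_of_natDegree_lt ((natDegree_matD_le r j).trans_lt ?_)
  omega

variable {G : Matrix (Fin k × Fin n) (Fin p) F[X]}

theorem natDegree_le_of_mul_eq_matE (hv0 : v ≠ 0) (hv : v.natDegree = k - 1)
    (hμ : Function.Injective μ) (hsum : ∑ t, l t = k - 1)
    (hG : ∀ r j, matE k M μ l r j = v * G r j) (r : Fin k × Fin n) (j : Fin p) :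
    (G r j).natDegree ≤ colDegree M j := by
  rcases eq_or_ne (G r j) 0 with h0 | h0
  · simp [h0]
  · have h1 := natDegree_matE_le (M := M) hμ hsum r j
    rw [hG r j, natDegree_mul hv0 h0, hv] at h1
    omega

/-- The coefficients of `E(z) / v(z)` at the degrees of the columns of `M(z)` are those of `M(z)`,
up to a constant, in the first block row, and vanish in the other block rows. -/
theorem coeff_colDegree_of_mul_eq_matE (hv0 : v ≠ 0) (hv : v.natDegree = k - 1)
    (hμ : Function.Injective μ) (hsum : ∑ t, l t = k - 1)
    (hG : ∀ r j, matE k M μ l r j = v * G r j) (b : Fin k) (i : Fin n) (j : Fin p) :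
    v.coeff (k - 1) * (G (b, i) j).coeff (colDegree M j) =
      if (b : ℕ) = 0 then leadingColMatrix M i j else 0 := by
  rw [← coeff_mul_add_eq_of_natDegree_le hv.le
    (natDegree_le_of_mul_eq_matE hv0 hv hμ hsum hG (b, i) j), ← hG, coeff_matE hμ (by omega)]
  split_ifs with hb
  · rw [matD, hb, Nat.sub_zero, add_comm, coeff_X_pow_mul]
    rfl
  · refine coeff_eq_zero_of_natDegree_lt ((natDegree_matD_le (b, i) j).trans_lt ?_)
    simp only
    omega

theorem colDegree_eq_of_mul_eq_matE (hk : 1 ≤ k) (hv0 : v ≠ 0) (hv : v.natDegree = k - 1)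
    (hμ : Function.Injective μ) (hsum : ∑ t, l t = k - 1)
    (hG : ∀ r j, matE k M μ l r j = v * G r j) (hM : IsColumnReduced M) (j : Fin p) :
    colDegree G j = colDegree M j := by
  refine le_antisymm (Finset.sup_le fun r _ =>
    natDegree_le_of_mul_eq_matE hv0 hv hμ hsum hG r j) ?_
  obtain ⟨i, hi⟩ := hM.exists_coeff_ne_zero j
  have h1 := coeff_colDegree_of_mul_eq_matE hv0 hv hμ hsum hG ⟨0, hk⟩ i j
  rw [if_pos rfl] at h1
  rw [← h1] at hi
  exact (le_natDegree_of_ne_zero (right_ne_zero_of_mul hi)).trans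
    (natDegree_le_colDegree G (⟨0, hk⟩, i) j)

theorem isColumnReduced_fromCols (hk : 1 ≤ k) (hv0 : v ≠ 0) (hv : v.natDegree = k - 1)
    (hμ : Function.Injective μ) (hsum : ∑ t, l t = k - 1)
    (hG : ∀ r j, matE k M μ l r j = v * G r j) (hM : IsColumnReduced M) (hM' : HasFullColRank M) :
    IsColumnReduced (Matrix.fromCols ((matC k M μ l).map C) G) := by
  intro c hc
  have hvk : v.coeff (k - 1) ≠ 0 := by
    rw [← hv]
    exact leadingCoeff_ne_zero.mpr hv0
  have hrow : ∀ (b : Fin k) (i : Fin n),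
      v.coeff (k - 1) * (matC k M μ l).mulVec (fun x => c (Sum.inl x)) (b, i) +
        (if (b : ℕ) = 0 then (leadingColMatrix M).mulVec (fun j => c (Sum.inr j)) i else 0) = 0 := by
    intro b i
    have h1 := congrArg (v.coeff (k - 1) * ·) (congrFun hc (b, i))
    simp only [Matrix.mulVec, dotProduct, Fintype.sum_sum_type, Pi.zero_apply, mul_zero, mul_add,
      leadingColMatrix, colDegree_fromCols_inl, colDegree_fromCols_inr, Matrix.fromCols_apply_inl,
      Matrix.fromCols_apply_inr, Matrix.map_apply, coeff_C_zero,
      colDegree_eq_of_mul_eq_matE hk hv0 hv hμ hsum hG hM] at h1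
    have h2 : v.coeff (k - 1) * ∑ j, (G (b, i) j).coeff (colDegree M j) * c (Sum.inr j) =
        if (b : ℕ) = 0 then (leadingColMatrix M).mulVec (fun j => c (Sum.inr j)) i else 0 := by
      simp only [Finset.mul_sum, ← mul_assoc, coeff_colDegree_of_mul_eq_matE hv0 hv hμ hsum hG]
      split_ifs
      · rfl
      · simp
    rw [← h2, ← h1]
    rfl
  have hinl : (fun x => c (Sum.inl x)) = 0 :=
    eq_zero_of_matC_mulVec_eq_zero hμ hsum.le hM' fun b hb i => by
      have h1 := hrow b i
      rw [if_neg hb, add_zero] at h1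
      exact (mul_eq_zero.mp h1).resolve_left hvk
  have hinr : (fun j => c (Sum.inr j)) = 0 := by
    refine hM _ (funext fun i => ?_)
    have h1 := hrow ⟨0, hk⟩ i
    rwa [hinl, Matrix.mulVec_zero, Pi.zero_apply, mul_zero, zero_add, if_pos rfl] at h1
  funext x
  rcases x with x | j
  · exact congrFun hinl x
  · exact congrFun hinr j

/-- The coefficient row of `v(z)` annihilates `C` and maps `E(z) / v(z)` to `M(z)`. Hence `F(z)`
inherits from `M(z)` and `C` the full column rank at every point. -/
theorem hasFullColRank_fromCols (hk : 1 ≤ k) (hv0 : v ≠ 0) (hv : v.natDegree = k - 1)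
    (hμ : Function.Injective μ) (hl : ∀ t, (X - C (μ t)) ^ l t ∣ v) (hsum : ∑ t, l t = k - 1)
    (hG : ∀ r j, matE k M μ l r j = v * G r j) (hM : HasFullColRank M) :
    HasFullColRank (Matrix.fromCols ((matC k M μ l).map C) G) := by
  intro a c hc
  have hvC : ∀ (i : Fin n) (x : (Σ t : Fin s, Fin (l t)) × Fin p),
      ∑ b : Fin k, v.coeff (k - 1 - b) * matC k M μ l (b, i) x = 0 := by
    intro i x
    rw [sum_coeff_mul_matC (by omega)]
    exact eval_iterate_derivative_eq_zero_of_dvd x.1.2.2 ((hl _).trans (dvd_mul_right _ _))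
  have hvG : ∀ i j, ∑ b : Fin k, C (v.coeff (k - 1 - b)) * G (b, i) j = M i j := by
    intro i j
    apply mul_left_cancel₀ hv0
    rw [← sum_coeff_mul_matD (k := k) (by omega) i j, Finset.mul_sum]
    have h1 : ∀ b : Fin k, v * (C (v.coeff (k - 1 - b)) * G (b, i) j) =
        C (v.coeff (k - 1 - b)) * matD k M (b, i) j - ∑ x : Σ t : Fin s, Fin (l t),
          hermitePoly μ l x * C (v.coeff (k - 1 - b) * matC k M μ l (b, i) (x, j)) := by
      intro b
      have h2 : v * (C (v.coeff (k - 1 - b)) * G (b, i) j) =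
          C (v.coeff (k - 1 - b)) * matE k M μ l (b, i) j := by
        rw [hG]
        ring
      rw [h2, matE, mul_sub, Finset.mul_sum]
      congr 1
      refine Finset.sum_congr rfl fun x _ => ?_
      rw [C_mul]
      ring
    rw [Finset.sum_congr rfl fun b _ => h1 b, Finset.sum_sub_distrib, Finset.sum_comm, sub_eq_self]
    refine Finset.sum_eq_zero fun x _ => ?_
    rw [← Finset.mul_sum, ← map_sum, hvC, map_zero, mul_zero]
  have hrow : ∀ r, (matC k M μ l).mulVec (fun x => c (Sum.inl x)) r +
      (G.map (Polynomial.eval a)).mulVec (fun j => c (Sum.inr j)) r = 0 := by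
    intro r
    have h1 := congrFun hc r
    simpa [Matrix.mulVec, dotProduct, Fintype.sum_sum_type] using h1
  have hinr : (fun j => c (Sum.inr j)) = 0 := by
    refine hM a _ (funext fun i => ?_)
    have hC : ∑ b : Fin k, v.coeff (k - 1 - b) *
        (matC k M μ l).mulVec (fun x => c (Sum.inl x)) (b, i) = 0 := by
      simp only [Matrix.mulVec, dotProduct, Finset.mul_sum, ← mul_assoc]
      rw [Finset.sum_comm]
      exact Finset.sum_eq_zero fun x _ => by rw [← Finset.sum_mul, hvC, zero_mul]
    have hE : ∑ b : Fin k, v.coeff (k - 1 - b) *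
        (G.map (Polynomial.eval a)).mulVec (fun j => c (Sum.inr j)) (b, i) =
        (M.map (Polynomial.eval a)).mulVec (fun j => c (Sum.inr j)) i := by
      simp only [Matrix.mulVec, dotProduct, Finset.mul_sum, ← mul_assoc, Matrix.map_apply]
      rw [Finset.sum_comm]
      refine Finset.sum_congr rfl fun j _ => ?_
      rw [← Finset.sum_mul, ← hvG i j, eval_finsetSum]
      simp only [eval_mul, eval_C]
    rw [← hE, ← zero_add (∑ b : Fin k, _), ← hC, ← Finset.sum_add_distrib]
    exact Finset.sum_eq_zero fun b _ => by rw [← mul_add, hrow, mul_zero]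
  have hinl : (fun x => c (Sum.inl x)) = 0 := by
    refine eq_zero_of_matC_mulVec_eq_zero hμ hsum.le hM fun b _ i => ?_
    have h1 := hrow (b, i)
    rwa [hinr, Matrix.mulVec_zero, Pi.zero_apply, add_zero] at h1
  funext x
  rcases x with x | j
  · exact congrFun hinl x
  · exact congrFun hinr j

end ColumnDegrees

/-! ### The kernel of the pencil is spanned by the columns of `F(z)` -/

section Assembly

variable {F : Type*} [Field F] {m n p k s : ℕ}

theorem DL_mul_matE (hk : 1 ≤ k) {P : Matrix (Fin m) (Fin n) F[X]}
    (hP : ∀ i j, (P i j).natDegree ≤ k) {v : F[X]} (hv : v.natDegree ≤ k - 1)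
    {M : Matrix (Fin n) (Fin p) F[X]} (hPM : P * M = 0) {μ : Fin s → F} {l : Fin s → ℕ}
    (hl : ∀ t, (X - C (μ t)) ^ l t ∣ v) : DL k P v * matE k M μ l = 0 := by
  ext1 r j
  have hD := congrFun (congrFun (DL_mul_matD hk hP hv hPM) r) j
  have hC := fun x => congrFun (congrFun (DL_mul_matC hk hP hv hPM hl) r) (x, j)
  simp only [Matrix.mul_apply, Matrix.zero_apply, Matrix.map_apply] at hD hC ⊢
  simp only [matE, mul_sub, Finset.sum_sub_distrib, hD, Finset.mul_sum, zero_sub, neg_eq_zero]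
  rw [Finset.sum_comm]
  refine Finset.sum_eq_zero fun x _ => ?_
  rw [← mul_zero (hermitePoly μ l x), ← hC x, Finset.mul_sum]
  exact Finset.sum_congr rfl fun c _ => by ring

theorem DL_mul_fromCols (hk : 1 ≤ k) {P : Matrix (Fin m) (Fin n) F[X]}
    (hP : ∀ i j, (P i j).natDegree ≤ k) {v : F[X]} (hv0 : v ≠ 0) (hv : v.natDegree ≤ k - 1)
    {M : Matrix (Fin n) (Fin p) F[X]} (hPM : P * M = 0) {μ : Fin s → F} {l : Fin s → ℕ}
    (hl : ∀ t, (X - C (μ t)) ^ l t ∣ v) {G : Matrix (Fin k × Fin n) (Fin p) F[X]}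
    (hG : ∀ r j, matE k M μ l r j = v * G r j) :
    DL k P v * Matrix.fromCols ((matC k M μ l).map C) G = 0 := by
  have hGE : v • (DL k P v * G) = DL k P v * matE k M μ l := by
    rw [← Matrix.mul_smul]
    congr 1
    ext1 r j
    exact (hG r j).symm
  have hG0 : DL k P v * G = 0 := by
    rw [DL_mul_matE hk hP hv hPM hl] at hGE
    ext1 r j
    have := congrFun (congrFun hGE r) j
    exact (mul_eq_zero.mp this).resolve_left hv0
  rw [Matrix.mul_fromCols, DL_mul_matC hk hP hv hPM hl, hG0]
  exact Matrix.fromCols_zero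

end Assembly

theorem toRat_fromCols_eq_matF {F : Type*} [Field F] {n p k s : ℕ} {v : F[X]} (hv0 : v ≠ 0)
    {M : Matrix (Fin n) (Fin p) F[X]} {μ : Fin s → F} {l : Fin s → ℕ}
    {G : Matrix (Fin k × Fin n) (Fin p) F[X]} (hG : ∀ r j, matE k M μ l r j = v * G r j) :
    toRat (Matrix.fromCols ((matC k M μ l).map C) G) = matF k M v μ l := by
  have hv' : algebraMap F[X] (RatFunc F) v ≠ 0 := by
    rwa [Ne, map_eq_zero_iff _ algebraMap_ratFunc_injective]
  ext1 r c
  rcases c with c | j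
  · rfl
  · simp only [matF, toRat, Matrix.map_apply, Matrix.fromCols_apply_inr, Matrix.smul_apply,
      smul_eq_mul, hG, map_mul]
    rw [inv_mul_cancel_left₀ hv']

end DLPencil

open DLPencil

theorem theorem4p11 {F : Type*} [Field F] [IsAlgClosed F] [CharZero F]
    (m n k p s : ℕ) (hk : 2 ≤ k)
    -- a matrix polynomial of grade `k`
    (P : Matrix (Fin m) (Fin n) (Polynomial F)) (hP : ∀ i j, (P i j).natDegree ≤ k)
    -- an ansatz polynomial of grade `k - 1` without infinite roots
    (v : Polynomial F) (hv : v.natDegree ≤ k - 1) (hv_inf : v.coeff (k - 1) ≠ 0)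
    (hdisj : Disjoint {a : F | DLPencil.IsEigenvalue P a} {a : F | v.IsRoot a})
    -- the distinct roots of `v` and their multiplicities
    (μ : Fin s → F) (hμ : Function.Injective μ) (hroots : Set.range μ = {a : F | v.IsRoot a})
    (l : Fin s → ℕ) (hl : ∀ t, l t = v.rootMultiplicity (μ t))
    -- a right minimal basis of `P`
    (hp : p = Module.finrank (RatFunc F) (DLPencil.ratKer P))
    (M : Matrix (Fin n) (Fin p) (Polynomial F)) (hM : DLPencil.IsRightMinimalBasis P M) :
    -- `C` has `(k - 1) p` columns
    Fintype.card ((Σ t : Fin s, Fin (l t)) × Fin p) = (k - 1) * p ∧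
    -- `[C, E / v]` is a matrix polynomial `A`
    ∃ A : Matrix (Fin k × Fin n) (((Σ t : Fin s, Fin (l t)) × Fin p) ⊕ Fin p) (Polynomial F),
      DLPencil.toRat A = DLPencil.matF k M v μ l ∧
      DLPencil.IsRightMinimalBasis (DLPencil.DL k P v) A ∧
      (∀ c, DLPencil.colDegree A (Sum.inl c) = 0) ∧
      (∀ j, DLPencil.colDegree A (Sum.inr j) = DLPencil.colDegree M j) := by
  have hk1 : 1 ≤ k := by omega
  have hv0 : v ≠ 0 := by
    rintro rfl
    exact hv_inf (coeff_zero _)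
  have hdeg : v.natDegree = k - 1 := le_antisymm hv (le_natDegree_of_ne_zero hv_inf)
  have hsum : ∑ t, l t = k - 1 := by rw [← hdeg]; exact sum_rootMultiplicity hv0 hμ hroots hl
  have hdvd : ∀ t, (X - C (μ t)) ^ l t ∣ v := fun t => by
    rw [hl t]
    exact pow_rootMultiplicity_dvd v (μ t)
  have hnotEig : ∀ a, v.IsRoot a → ¬ IsEigenvalue P a := fun a ha he =>
    Set.disjoint_left.mp hdisj he ha
  have hcard : Fintype.card ((Σ t : Fin s, Fin (l t)) × Fin p) = (k - 1) * p := by simp [hsum]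
  choose G hG using dvd_matE (k := k) (M := M) hv0 hμ hdvd (hsum.trans hdeg.symm)
  have hMfull := hM.hasFullColRank
  have hMred := hM.isColumnReduced
  let A := Matrix.fromCols ((matC k M μ l).map C) (Matrix.of G)
  have hG' : ∀ r j, matE k M μ l r j = v * Matrix.of G r j := hG
  have hAred : IsColumnReduced A :=
    isColumnReduced_fromCols hk1 hv0 hdeg hμ hsum hG' hMred hMfull
  have hAfull : HasFullColRank A :=
    hasFullColRank_fromCols hk1 hv0 hdeg hμ hdvd hsum hG' hMfull
  have hLA : DL k P v * A = 0 := DL_mul_fromCols hk1 hP hv0 hv hM.1.mul_eq_zero hdvd hG'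
  have hle : Submodule.span (RatFunc F) (Set.range (toRat A).col) ≤ ratKer (DL k P v) := by
    rw [← Matrix.range_mulVecLin]
    rintro _ ⟨x, rfl⟩
    change (toRat (DL k P v)).mulVec ((toRat A).mulVec x) = 0
    rw [Matrix.mulVec_mulVec, ← toRat_mul, hLA]
    ext i
    simp [toRat, Matrix.mulVec, dotProduct]
  have hbasis : IsPolynomialBasis (ratKer (DL k P v)) A := by
    refine ⟨hAred.linearIndependent, Submodule.eq_of_le_of_finrank_le hle ?_⟩
    rw [finrank_span_eq_card hAred.linearIndependent, Fintype.card_sum, hcard, Fintype.card_fin]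
    refine (finrank_ratKer_DL_le hk1 hP hdeg hv0 hM.1 hMfull hnotEig).trans (le_of_eq ?_)
    obtain ⟨k, rfl⟩ := Nat.exists_eq_add_of_le' hk1
    rw [Nat.add_sub_cancel]
    ring
  refine ⟨hcard, A, toRat_fromCols_eq_matF hv0 hG',
    isMinimalBasis_of_hasFullColRank_of_isColumnReduced hbasis hAfull hAred,
    colDegree_fromCols_inl _ _, fun j => ?_⟩
  exact colDegree_eq_of_mul_eq_matE hk1 hv0 hdeg hμ hsum hG' hMred j
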